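/- **Setting.** Let $V$ be a finite-dimensional normed real vector space, $\Lambda\subset V$ a full lattice, $\hat V=\mathrm{Hom}(V,\mathbb R)$, $\hat\Lambda=\mathrm{Hom}(\Lambda,\mathbb Z)\subset\hat V$, $T=V/\Lambda$, $\hat T=\hat V/\hat\Lambda$. *Differential cochains.* For a smooth space $Y$ (a smooth manifold or, more generally, a diffeological space), a lattice $L\subset W$ and $p\ge q$, $p\geq 1$, let $$\mathcal C^p(q)(Y;L)=C^p(Y;L)\times C^{p-1}(Y;W)\times\Omega^p(Y;W)$$ (smooth singular cochains and smooth differential forms), with $\check d(c,h,\omega)=(\delta c,\;c-\tilde\omega-\delta h,\;d\omega)$, where $\tilde\omega$ denotes the cochain obtained by integrating $\omega$; put $\mathrm{Curv}(c,h,\omega)=\omega$. The Hopkins–Singer product combined with the pairings $\Lambda\otimes\hat\Lambda\to\mathbb Z$, $V\otimes\hat V\to\mathbb R$ is $$(c_1,h_1,\omega_1)\cdot(c_2,h_2,\omega_2)=\bigl(c_1\smile c_2,\;(-1)^{p_1}c_1\smile h_2+h_1\smile\tilde\omega_2+B(\omega_1,\omega_2),\;\omega_1\wedge\omega_2\bigr),$$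 where $p_1$ is the degree of the first factor and $B$ is the natural chain homotopy between $\smile$ and $\wedge$, $\delta B(\omega_1,\omega_2)+B(d\omega_1,\omega_2)+(-1)^{p_1}B(\omega_1,d\omega_2)=\tilde\omega_1\smile\tilde\omega_2-\widetilde{\omega_1\wedge\omega_2}$, obtained by acyclic models from the radial contraction of the standard simplices. *Geometric groupoid.* For $p\ge2$ the objects of $\mathcal H^p(Y;L)$ are the $x\in\mathcal C^p(p)(Y;L)$ with $\check dx=0$. A geometric morphism $x\to y$ is an $\alpha\in\mathcal C^{p-1}(p-1)(Y;L)$ with $x=y+\check d\alpha$, and composition is addition. A geometric trivialisation of $x$ is an $\alpha$ with $\check d\alpha=x$. *Model bundles.* Let $ET\to BT$ be a principal $T$-bundle with connection (for example a universal one; universality is not needed), with a fixed cocycle $c\in\mathcal H^2(BT;\Lambda)$ representing it and a fixed geometric trivialisation $\alpha\in\mathcal C^1(1)(ET;\Lambda)$ of the pullback of $c$ to $ET$, with $T$-invariant curvature. Fix $E\hat T\to B\hat T$, $\hat c$, $\hat\alpha$ likewise for $\hat T$ and $\hat\Lambda$. *$T$-duality pair.* Let $X$ be a smooth manifold, and let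 $\pi:(P,\nabla)\to X$ and $\hat\pi:(\hat P,\hat\nabla)\to X$ be principal $T$- and $\hat T$-bundles with connection, with classifying maps $f:X\to BT$, $\bar f:P\to ET$ and $\hat f:X\to B\hat T$, $\bar{\hat f}:\hat P\to E\hat T$ adapted to the connections. Put $\check P=f^*c\in\mathcal H^2(X;\Lambda)$ and $\check{\hat P}=\hat f^*\hat c\in\mathcal H^2(X;\hat\Lambda)$. Let $\sigma\in\mathcal C^3(3)(X;\mathbb Z)$ be a geometric trivialisation of $\check P\cdot\check{\hat P}$. *Diagonal trivialisations and canonical twists.* Write $\mathrm{pr}_2:P\times_XP\to P$ for the second projection and $\Delta_P:p\mapsto(p,p)$ for the diagonal section of the pulled-back bundle $P\times_XP\to P$. Put $\delta_P=\Delta_P^*(\bar f\circ\mathrm{pr}_2)^*\alpha\in\mathcal C^1(1)(P;\Lambda)$, a geometric trivialisation of $\pi^*\check P$, and define $\hat\delta_{\hat P}\in\mathcal C^1(1)(\hat P;\hat\Lambda)$ likewise. Put $$\tau=\pi^*\sigma-\delta_P\cdot\pi^*\check{\hat P},\qquad\hat\tau=\hat\pi^*\sigma-\hat\pi^*\check P\cdot\hat\delta_{\hat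 P}.$$ **Lemma.** The twists $\tau$ and $\hat\tau$ are objects of $\mathcal H^3(P;\mathbb Z)$ and $\mathcal H^3(\hat P;\mathbb Z)$. Let $\hat\pi:P\times_X\hat P\to P$ and $\pi:P\times_X\hat P\to\hat P$ now denote the projections of the fibre product. Then $\hat\pi^*\delta_P\cdot\pi^*\hat\delta_{\hat P}\in\mathcal C^2(2)(P\times_X\hat P;\mathbb Z)$ is a geometric morphism $$\hat\pi^*\delta_P\cdot\pi^*\hat\delta_{\hat P}:\ \hat\pi^*\tau\longrightarrow\pi^*\hat\tau$$ in the geometric groupoid $\mathcal H^3(P\times_X\hat P;\mathbb Z)$; that is, both ends are objects and $\hat\pi^*\tau=\pi^*\hat\tau+\check d\bigl(\hat\pi^*\delta_P\cdot\pi^*\hat\delta_{\hat P}\bigr)$. -/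

import Mathlib

open Diffeology
open scoped ContDiff Manifold Topology

noncomputable section

/-- Euclidean `n`-space, the domain of plots. -/
abbrev Euc (n : ℕ) : Type := EuclideanSpace ℝ (Fin n)

/-- `V`-valued `k`-forms on Euclidean `n`-space. -/
abbrev EForm (n k : ℕ) (V : Type*) [NormedAddCommGroup V] [NormedSpace ℝ V] : Type _ :=
  Euc n → Euc n [⋀^Fin k]→L[ℝ] V

section Wedge

variable {V W U : Type*} [NormedAddCommGroup V] [NormedSpace ℝ V]
  [NormedAddCommGroup W] [NormedSpace ℝ W] [NormedAddCommGroup U] [NormedSpace ℝ U]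

lemma update_front_front {M : Type*} {p q : ℕ} (v : Fin (p + q) → M) (i : Fin p) (z : M) :
    (fun k => Function.update v (Fin.castAdd q i) z (Fin.castAdd q k)) =
      Function.update (fun k => v (Fin.castAdd q k)) i z := by
  ext1 k; simp [Function.update_apply]

lemma update_front_back {M : Type*} {p q : ℕ} (v : Fin (p + q) → M) (i : Fin p) (z : M) :
    (fun k => Function.update v (Fin.castAdd q i) z (Fin.natAdd p k)) =
      fun k => v (Fin.natAdd p k) := by
  ext1 k; rw [Function.update_of_ne]; simp [Fin.ext_iff]; omega

lemma update_back_back {M : Type*} {p q : ℕ} (v : Fin (p + q) → M) (j : Fin q) (z : M) :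
    (fun k => Function.update v (Fin.natAdd p j) z (Fin.natAdd p k)) =
      Function.update (fun k => v (Fin.natAdd p k)) j z := by
  ext1 k; simp [Function.update_apply]

lemma update_back_front {M : Type*} {p q : ℕ} (v : Fin (p + q) → M) (j : Fin q) (z : M) :
    (fun k => Function.update v (Fin.natAdd p j) z (Fin.castAdd q k)) =
      fun k => v (Fin.castAdd q k) := by
  ext1 k; rw [Function.update_of_ne]; simp [Fin.ext_iff]; omega

/-- The tensor product `(v₁,…,vₙ) ↦ β (a (v₁,…,v_p)) (b (v_{p+1},…,vₙ))`. -/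
def tensorAlt (β : V →L[ℝ] W →L[ℝ] U) {m p q n : ℕ} (h : p + q = n)
    (a : Euc m [⋀^Fin p]→L[ℝ] V) (b : Euc m [⋀^Fin q]→L[ℝ] W) :
    ContinuousMultilinearMap ℝ (fun _ : Fin n => Euc m) U where
  toFun v := β (a fun i => v (Fin.cast h (Fin.castAdd q i)))
    (b fun j => v (Fin.cast h (Fin.natAdd p j)))
  map_update_add' := by
    intro _ v i x y
    obtain rfl : ‹DecidableEq (Fin n)› = instDecidableEqFin n := Subsingleton.elim _ _
    subst h
    refine Fin.addCases (fun i => ?_) (fun j => ?_) i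
    · simp only [Fin.cast_eq_self, update_front_front, update_front_back]; simp
    · simp only [Fin.cast_eq_self, update_back_back, update_back_front]; simp
  map_update_smul' := by
    intro _ v i c x
    obtain rfl : ‹DecidableEq (Fin n)› = instDecidableEqFin n := Subsingleton.elim _ _
    subst h
    refine Fin.addCases (fun i => ?_) (fun j => ?_) i
    · simp only [Fin.cast_eq_self, update_front_front, update_front_back]; simp
    · simp only [Fin.cast_eq_self, update_back_back, update_back_front]; simp
  cont := by fun_prop

/-- The wedge product of alternating forms, with respect to the bilinear pairing `β` of the
values, normalised by `1 / (p! q!)`. -/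
def wedgeAlt (β : V →L[ℝ] W →L[ℝ] U) {m p q n : ℕ} (h : p + q = n)
    (a : Euc m [⋀^Fin p]→L[ℝ] V) (b : Euc m [⋀^Fin q]→L[ℝ] W) : Euc m [⋀^Fin n]→L[ℝ] U :=
  ((p.factorial * q.factorial : ℝ)⁻¹) • ContinuousMultilinearMap.alternatization (tensorAlt β h a b)

lemma wedgeAlt_apply (β : V →L[ℝ] W →L[ℝ] U) {m p q n : ℕ} (h : p + q = n)
    (a : Euc m [⋀^Fin p]→L[ℝ] V) (b : Euc m [⋀^Fin q]→L[ℝ] W) (v : Fin n → Euc m) :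
    wedgeAlt β h a b v = ((p.factorial * q.factorial : ℝ)⁻¹) •
      ∑ σ : Equiv.Perm (Fin n), Equiv.Perm.sign σ •
        β (a fun i => v (σ (Fin.cast h (Fin.castAdd q i))))
          (b fun j => v (σ (Fin.cast h (Fin.natAdd p j)))) := by
  simp only [wedgeAlt, ContinuousAlternatingMap.smul_apply,
    ContinuousMultilinearMap.alternatization_apply_apply]
  rfl

lemma norm_wedgeAlt_le (β : V →L[ℝ] W →L[ℝ] U) {m p q n : ℕ} (h : p + q = n)
    (a : Euc m [⋀^Fin p]→L[ℝ] V) (b : Euc m [⋀^Fin q]→L[ℝ] W) :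
    ‖wedgeAlt β h a b‖ ≤ ((p.factorial * q.factorial : ℝ)⁻¹ *
      (Fintype.card (Equiv.Perm (Fin n)) * ‖β‖)) * ‖a‖ * ‖b‖ := by
  refine ContinuousAlternatingMap.opNorm_le_bound _ (by positivity) fun v => ?_
  rw [wedgeAlt_apply, norm_smul, Real.norm_of_nonneg (by positivity)]
  have key : ∀ σ : Equiv.Perm (Fin n), ‖Equiv.Perm.sign σ •
        β (a fun i => v (σ (Fin.cast h (Fin.castAdd q i))))
          (b fun j => v (σ (Fin.cast h (Fin.natAdd p j))))‖ ≤ ‖β‖ * ‖a‖ * ‖b‖ * ∏ i, ‖v i‖ := by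
    intro σ
    have h1 : ∀ x : U, ‖Equiv.Perm.sign σ • x‖ = ‖x‖ := fun x => by
      rcases Int.units_eq_one_or (Equiv.Perm.sign σ) with h | h <;> simp [h]
    have h2 : ∏ i, ‖v i‖ = (∏ i : Fin p, ‖v (σ (Fin.cast h (Fin.castAdd q i)))‖) *
        ∏ j : Fin q, ‖v (σ (Fin.cast h (Fin.natAdd p j)))‖ := by
      rw [← Equiv.prod_comp σ]; subst h; simp [Fin.prod_univ_add]
    rw [h1, h2]
    refine (β.le_opNorm₂ _ _).trans ?_
    have h3 := a.le_opNorm fun i => v (σ (Fin.cast h (Fin.castAdd q i)))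
    have h4 := b.le_opNorm fun j => v (σ (Fin.cast h (Fin.natAdd p j)))
    calc _ ≤ ‖β‖ * (‖a‖ * ∏ i : Fin p, ‖v (σ (Fin.cast h (Fin.castAdd q i)))‖) *
          (‖b‖ * ∏ j : Fin q, ‖v (σ (Fin.cast h (Fin.natAdd p j)))‖) := by gcongr
      _ = _ := by ring
  calc _ ≤ (p.factorial * q.factorial : ℝ)⁻¹ *
        ∑ σ : Equiv.Perm (Fin n), ‖β‖ * ‖a‖ * ‖b‖ * ∏ i, ‖v i‖ := by
        gcongr; exact norm_sum_le_of_le _ fun σ _ => key σ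
    _ = _ := by simp only [Finset.sum_const, Finset.card_univ, nsmul_eq_mul]; ring

lemma wedgeAlt_add_left (β : V →L[ℝ] W →L[ℝ] U) {m p q n : ℕ} (h : p + q = n)
    (a a' : Euc m [⋀^Fin p]→L[ℝ] V) (b : Euc m [⋀^Fin q]→L[ℝ] W) :
    wedgeAlt β h (a + a') b = wedgeAlt β h a b + wedgeAlt β h a' b := by
  ext v
  simp only [ContinuousAlternatingMap.add_apply, wedgeAlt_apply, map_add,
    _root_.add_apply, smul_add, Finset.sum_add_distrib]

lemma wedgeAlt_add_right (β : V →L[ℝ] W →L[ℝ] U) {m p q n : ℕ} (h : p + q = n)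
    (a : Euc m [⋀^Fin p]→L[ℝ] V) (b b' : Euc m [⋀^Fin q]→L[ℝ] W) :
    wedgeAlt β h a (b + b') = wedgeAlt β h a b + wedgeAlt β h a b' := by
  ext v
  simp only [ContinuousAlternatingMap.add_apply, wedgeAlt_apply, map_add,
    smul_add, Finset.sum_add_distrib]

lemma wedgeAlt_smul_left (β : V →L[ℝ] W →L[ℝ] U) {m p q n : ℕ} (h : p + q = n) (c : ℝ)
    (a : Euc m [⋀^Fin p]→L[ℝ] V) (b : Euc m [⋀^Fin q]→L[ℝ] W) :
    wedgeAlt β h (c • a) b = c • wedgeAlt β h a b := by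
  ext v
  simp only [ContinuousAlternatingMap.smul_apply, wedgeAlt_apply, map_smul,
    _root_.smul_apply, smul_comm _ c, ← Finset.smul_sum]

lemma wedgeAlt_smul_right (β : V →L[ℝ] W →L[ℝ] U) {m p q n : ℕ} (h : p + q = n) (c : ℝ)
    (a : Euc m [⋀^Fin p]→L[ℝ] V) (b : Euc m [⋀^Fin q]→L[ℝ] W) :
    wedgeAlt β h a (c • b) = c • wedgeAlt β h a b := by
  ext v
  simp only [ContinuousAlternatingMap.smul_apply, wedgeAlt_apply, map_smul,
    smul_comm _ c, ← Finset.smul_sum]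

/-- The wedge product as a continuous bilinear map. -/
def wedgeCLM (β : V →L[ℝ] W →L[ℝ] U) {m p q n : ℕ} (h : p + q = n) :
    (Euc m [⋀^Fin p]→L[ℝ] V) →L[ℝ] (Euc m [⋀^Fin q]→L[ℝ] W) →L[ℝ] Euc m [⋀^Fin n]→L[ℝ] U :=
  LinearMap.mkContinuous₂ (LinearMap.mk₂ ℝ (wedgeAlt β h) (wedgeAlt_add_left β h)
    (wedgeAlt_smul_left β h) (wedgeAlt_add_right β h) (wedgeAlt_smul_right β h)) _
    (norm_wedgeAlt_le β h)

lemma wedgeCLM_apply (β : V →L[ℝ] W →L[ℝ] U) {m p q n : ℕ} (h : p + q = n)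
    (a : Euc m [⋀^Fin p]→L[ℝ] V) (b : Euc m [⋀^Fin q]→L[ℝ] W) :
    wedgeCLM β h a b = wedgeAlt β h a b := rfl

lemma contDiff_wedgeAlt (β : V →L[ℝ] W →L[ℝ] U) {l m p q n : ℕ} (h : p + q = n)
    {a : Euc l → Euc m [⋀^Fin p]→L[ℝ] V} {b : Euc l → Euc m [⋀^Fin q]→L[ℝ] W}
    (ha : ContDiff ℝ ∞ a) (hb : ContDiff ℝ ∞ b) :
    ContDiff ℝ ∞ fun x => wedgeAlt β h (a x) (b x) := by
  simp only [← wedgeCLM_apply]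
  exact ((wedgeCLM β h).contDiff.comp ha).clm_apply hb

end Wedge

/-- Pullback of a differential form on `Euc n` along a map `f : Euc m → Euc n`. -/
def EForm.pull {V : Type*} [NormedAddCommGroup V] [NormedSpace ℝ V] {m n k : ℕ}
    (f : Euc m → Euc n) (a : EForm n k V) : EForm m k V :=
  fun x => (a (f x)).compContinuousLinearMap (fderiv ℝ f x)

lemma wedgeAlt_comp {V W U : Type*} [NormedAddCommGroup V] [NormedSpace ℝ V]
    [NormedAddCommGroup W] [NormedSpace ℝ W] [NormedAddCommGroup U] [NormedSpace ℝ U]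
    (β : V →L[ℝ] W →L[ℝ] U) {l m p q n : ℕ} (h : p + q = n)
    (a : Euc m [⋀^Fin p]→L[ℝ] V) (b : Euc m [⋀^Fin q]→L[ℝ] W) (f : Euc l →L[ℝ] Euc m) :
    wedgeAlt β h (a.compContinuousLinearMap f) (b.compContinuousLinearMap f) =
      (wedgeAlt β h a b).compContinuousLinearMap f := by
  ext v
  simp only [wedgeAlt_apply, ContinuousAlternatingMap.compContinuousLinearMap_apply,
    Function.comp_def]

/-- A smooth differential `k`-form with values in `V` on a diffeological space: a smooth form on
the domain of every plot (its pullback along the plot), compatible with smooth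
reparametrisations. On a smooth manifold these are the usual differential forms. -/
@[ext]
structure DForm (X : Type*) [DiffeologicalSpace X] (k : ℕ) (V : Type*) [NormedAddCommGroup V]
    [NormedSpace ℝ V] where
  toFun : ∀ (n : ℕ) (p : Euc n → X), IsPlot p → EForm n k V
  smooth' : ∀ (n : ℕ) (p : Euc n → X) (hp : IsPlot p), ContDiff ℝ ∞ (toFun n p hp)
  natural' : ∀ (m n : ℕ) (p : Euc n → X) (hp : IsPlot p) (f : Euc m → Euc n)
    (hf : ContDiff ℝ ∞ f), toFun m (p ∘ f) (isPlot_reparam hp hf) = (toFun n p hp).pull f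

namespace DForm

variable {X Y : Type*} [DiffeologicalSpace X] [DiffeologicalSpace Y] {k : ℕ}
  {V W U : Type*} [NormedAddCommGroup V] [NormedSpace ℝ V]
  [NormedAddCommGroup W] [NormedSpace ℝ W] [NormedAddCommGroup U] [NormedSpace ℝ U]

instance : Zero (DForm X k V) where
  zero :=
    { toFun := fun _ _ _ _ => 0
      smooth' := fun _ _ _ => contDiff_const
      natural' := fun _ _ _ _ _ _ => by ext; simp [EForm.pull] }

instance : Add (DForm X k V) where
  add a b :=
    { toFun := fun n p hp x => a.toFun n p hp x + b.toFun n p hp x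
      smooth' := fun n p hp => (a.smooth' n p hp).add (b.smooth' n p hp)
      natural' := fun m n p hp f hf => by
        ext; simp [a.natural' m n p hp f hf, b.natural' m n p hp f hf, EForm.pull] }

instance : Neg (DForm X k V) where
  neg a :=
    { toFun := fun n p hp x => -a.toFun n p hp x
      smooth' := fun n p hp => (a.smooth' n p hp).neg
      natural' := fun m n p hp f hf => by
        ext; simp [a.natural' m n p hp f hf, EForm.pull] }

instance : AddCommGroup (DForm X k V) where
  add_assoc a b c := DForm.ext <| by funext n p hp x; exact add_assoc _ _ _
  zero_add a := DForm.ext <| by funext n p hp x; exact zero_add _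
  add_zero a := DForm.ext <| by funext n p hp x; exact add_zero _
  add_comm a b := DForm.ext <| by funext n p hp x; exact add_comm _ _
  neg_add_cancel a := DForm.ext <| by funext n p hp x; exact neg_add_cancel _
  nsmul := nsmulRec
  zsmul := zsmulRec

lemma toFun_add (a b : DForm X k V) (n : ℕ) (p : Euc n → X) (hp : IsPlot p) :
    (a + b).toFun n p hp = a.toFun n p hp + b.toFun n p hp := rfl

/-- The exterior derivative. -/
def d (a : DForm X k V) : DForm X (k + 1) V where
  toFun n p hp := extDeriv (a.toFun n p hp)
  smooth' n p hp := by
    change ContDiff ℝ ∞ fun x => ContinuousAlternatingMap.alternatizeUncurryFinCLM ℝ (Euc n) V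
      (fderiv ℝ (a.toFun n p hp) x)
    exact (ContinuousLinearMap.contDiff _).comp
      ((a.smooth' n p hp).fderiv_right (m := ∞) (by simp))
  natural' m n p hp f hf := by
    rw [a.natural' m n p hp f hf]
    funext x
    exact extDeriv_pullback (r := ∞) ((a.smooth' n p hp).differentiable (by simp) _)
      hf.contDiffAt (by
      simpa using (WithTop.coe_le_coe.2 le_top : ((2 : ℕ∞) : WithTop ℕ∞) ≤ ∞))

lemma d_add (a b : DForm X k V) : (a + b).d = a.d + b.d := by
  ext1; funext n p hp x
  exact extDeriv_add ((a.smooth' n p hp).differentiable (by simp) _)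
    ((b.smooth' n p hp).differentiable (by simp) _)

/-- Pullback along a smooth map. -/
def pullback (f : X → Y) (hf : DSmooth f) (a : DForm Y k V) : DForm X k V where
  toFun n p hp := a.toFun n (f ∘ p) (hp.dSmooth_comp hf)
  smooth' n p hp := a.smooth' n (f ∘ p) _
  natural' m n p hp g hg := a.natural' m n (f ∘ p) (hp.dSmooth_comp hf) g hg

/-- The wedge product with respect to a bilinear pairing of the values. -/
def wedge (β : V →L[ℝ] W →L[ℝ] U) {p q n : ℕ} (h : p + q = n) (a : DForm X p V)
    (b : DForm X q W) : DForm X n U where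
  toFun m r hr x := wedgeAlt β h (a.toFun m r hr x) (b.toFun m r hr x)
  smooth' m r hr := contDiff_wedgeAlt β h (a.smooth' m r hr) (b.smooth' m r hr)
  natural' m n r hr f hf := by
    rw [a.natural' m n r hr f hf, b.natural' m n r hr f hf]
    funext x
    exact wedgeAlt_comp β h _ _ _

end DForm

/-- The standard `n`-simplex, with vertices `0, e₁, …, eₙ`. -/
def stdSimp (n : ℕ) : Set (Euc n) := {x | (∀ i, 0 ≤ x i) ∧ ∑ i, x i ≤ 1}

/-- The vertices `0, e₁, …, eₙ` of the standard simplex. -/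
def vert {n : ℕ} : Fin (n + 1) → Euc n := Fin.cons 0 fun i => EuclideanSpace.single i 1

/-- Barycentric coordinates with respect to these vertices. -/
def bary {n : ℕ} (x : Euc n) : Fin (n + 1) → ℝ := Fin.cons (1 - ∑ i, x i) fun i => x i

/-- The affine map `Euc m → Euc n` sending the vertex `j` to the vertex `θ j`. -/
def simpMap {m n : ℕ} (θ : Fin (m + 1) → Fin (n + 1)) (x : Euc m) : Euc n :=
  ∑ j, bary x j • vert (θ j)

lemma simpMap_vert {m n : ℕ} (θ : Fin (m + 1) → Fin (n + 1)) (j : Fin (m + 1)) :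
    simpMap θ (vert j) = vert (θ j) := by
  refine Fin.cases ?_ (fun i => ?_) j <;>
    simp [simpMap, Fin.sum_univ_succ, bary, vert]

lemma contDiff_simpMap {m n : ℕ} (θ : Fin (m + 1) → Fin (n + 1)) :
    ContDiff ℝ ∞ (simpMap θ) := by
  unfold simpMap
  refine ContDiff.sum fun j _ => ContDiff.fun_smul ?_ contDiff_const
  refine Fin.cases ?_ (fun i => ?_) j
  · simp only [bary, Fin.cons_zero]; fun_prop
  · simp only [bary, Fin.cons_succ]; fun_prop

lemma convex_stdSimp (n : ℕ) : Convex ℝ (stdSimp n) := by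
  intro x hx y hy a b ha hb hab
  refine ⟨fun i => ?_, ?_⟩
  · have := hx.1 i; have := hy.1 i
    simp only [PiLp.add_apply, PiLp.smul_apply, smul_eq_mul]; positivity
  · simp only [PiLp.add_apply, PiLp.smul_apply, smul_eq_mul, Finset.sum_add_distrib,
      ← Finset.mul_sum]
    nlinarith [hx.2, hy.2]

lemma vert_mem (n : ℕ) (j : Fin (n + 1)) : vert j ∈ stdSimp n := by
  refine Fin.cases ?_ (fun i => ?_) j
  · simp [vert, stdSimp]
  · refine ⟨fun k => ?_, ?_⟩
    · simp only [vert, Fin.cons_succ, PiLp.single_apply]; split_ifs <;> simp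
    · simp [vert, PiLp.single_apply]

lemma simpMap_mem {m n : ℕ} (θ : Fin (m + 1) → Fin (n + 1)) {x : Euc m} (hx : x ∈ stdSimp m) :
    simpMap θ x ∈ stdSimp n := by
  refine (convex_stdSimp n).sum_mem (fun j _ => ?_) ?_ fun j _ => vert_mem n _
  · refine Fin.cases ?_ (fun i => ?_) j
    · simpa [bary] using hx.2
    · simpa [bary] using hx.1 i
  · simp [Fin.sum_univ_succ, bary]

lemma isCompact_stdSimp (n : ℕ) : IsCompact (stdSimp n) := by
  refine Metric.isCompact_of_isClosed_isBounded ?_ ?_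
  · have : stdSimp n = (⋂ i, {x : Euc n | 0 ≤ x i}) ∩ {x | ∑ i, x i ≤ 1} := by
      ext; simp [stdSimp]
    rw [this]
    exact (isClosed_iInter fun i => isClosed_le (by fun_prop) (by fun_prop)).inter
      (isClosed_le (by fun_prop) (by fun_prop))
  · refine (Metric.isBounded_closedBall (x := (0 : Euc n)) (r := n)).subset fun x hx => ?_
    rw [mem_closedBall_zero_iff]
    have h0 : ‖x‖ = ‖∑ i, x i • (EuclideanSpace.single i (1 : ℝ) : Euc n)‖ := by
      congr 1; ext j; simp [Pi.single_apply]
    have h1 : ∀ i, x i ≤ 1 := fun i =>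
      (Finset.single_le_sum (fun j _ => hx.1 j) (Finset.mem_univ i)).trans hx.2
    rw [h0]
    refine (norm_sum_le_of_le _ (n := fun _ => (1 : ℝ)) fun i _ => ?_).trans (by simp)
    rw [norm_smul, Real.norm_of_nonneg (hx.1 i)]; simpa using h1 i

/-- Smooth singular `n`-simplices: maps from the standard simplex with a smooth extension to the
surrounding Euclidean space. (A smooth extension to some neighbourhood of the simplex gives one to
the whole space, by precomposing with a smooth map into the neighbourhood that fixes the simplex.) -/
@[ext]
structure SmoothSimplex (X : Type*) [DiffeologicalSpace X] (n : ℕ) where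
  toFun : stdSimp n → X
  exists_extension' : ∃ p : Euc n → X, IsPlot p ∧ ∀ x : stdSimp n, p x = toFun x

namespace SmoothSimplex

variable {X Y : Type*} [DiffeologicalSpace X] [DiffeologicalSpace Y] {n : ℕ}

/-- A chosen smooth extension of a smooth singular simplex. -/
def extension (s : SmoothSimplex X n) : Euc n → X := s.exists_extension'.choose

lemma isPlot_extension (s : SmoothSimplex X n) : IsPlot s.extension :=
  s.exists_extension'.choose_spec.1

lemma extension_apply (s : SmoothSimplex X n) (x : stdSimp n) : s.extension x = s.toFun x :=
  s.exists_extension'.choose_spec.2 x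

/-- Precomposition with the affine map of simplices given on vertices by `θ`. -/
def restrict {m : ℕ} (θ : Fin (m + 1) → Fin (n + 1)) (s : SmoothSimplex X n) :
    SmoothSimplex X m where
  toFun x := s.toFun ⟨simpMap θ x, simpMap_mem θ x.2⟩
  exists_extension' := ⟨s.extension ∘ simpMap θ,
    isPlot_reparam s.isPlot_extension (contDiff_simpMap θ),
    fun x => s.extension_apply ⟨simpMap θ x, simpMap_mem θ x.2⟩⟩

/-- The `i`-th face. -/
def face (i : Fin (n + 2)) (s : SmoothSimplex X (n + 1)) : SmoothSimplex X n :=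
  s.restrict i.succAbove

/-- The image of a simplex under a smooth map. -/
def map (f : X → Y) (hf : DSmooth f) (s : SmoothSimplex X n) : SmoothSimplex Y n where
  toFun x := f (s.toFun x)
  exists_extension' := ⟨f ∘ s.extension, s.isPlot_extension.dSmooth_comp hf,
    fun x => by simp [s.extension_apply]⟩

/-- The `0`-simplex at a point. -/
def point (x : X) : SmoothSimplex X 0 where
  toFun _ := x
  exists_extension' := ⟨fun _ => x, isPlot_const, fun _ => rfl⟩

end SmoothSimplex

section Cochains

variable {X Y : Type*} [DiffeologicalSpace X] [DiffeologicalSpace Y]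

/-- Smooth singular `n`-cochains with values in `A`. -/
abbrev Cochain (X : Type*) [DiffeologicalSpace X] (n : ℕ) (A : Type*) : Type _ :=
  SmoothSimplex X n → A

/-- The singular coboundary. -/
def coboundary {A : Type*} [AddCommGroup A] {n : ℕ} (c : Cochain X n A) : Cochain X (n + 1) A :=
  fun s => ∑ i : Fin (n + 2), (-1 : ℤ) ^ (i : ℕ) • c (s.face i)

/-- The inclusion of the front `p`-face. -/
def frontIncl {p q n : ℕ} (h : p + q = n) (i : Fin (p + 1)) : Fin (n + 1) :=
  ⟨i, by omega⟩

/-- The inclusion of the back `q`-face. -/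
def backIncl {p q n : ℕ} (h : p + q = n) (j : Fin (q + 1)) : Fin (n + 1) :=
  ⟨p + j, by omega⟩

/-- The cup product of singular cochains with respect to a pairing `μ` of the coefficients. -/
def cupCochain {A B C : Type*} (μ : A → B → C) {p q n : ℕ} (h : p + q = n)
    (a : Cochain X p A) (b : Cochain X q B) : Cochain X n C :=
  fun s => μ (a (s.restrict (frontIncl h))) (b (s.restrict (backIncl h)))

variable {V W U : Type*} [NormedAddCommGroup V] [NormedSpace ℝ V]
  [NormedAddCommGroup W] [NormedSpace ℝ W] [NormedAddCommGroup U] [NormedSpace ℝ U]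

/-- The integral of a top degree form over the standard simplex. -/
def EForm.simpInt {n : ℕ} (a : EForm n n V) : V :=
  ∫ x in stdSimp n, a x fun i => EuclideanSpace.single i (1 : ℝ)

/-- The singular cochain `ã` obtained by integrating the form `a`. The pullback of `a` to
the simplex does not depend on the chosen smooth extension. -/
def DForm.toCochain {n : ℕ} (a : DForm X n V) : Cochain X n V :=
  fun s => (a.toFun n s.extension s.isPlot_extension).simpInt

lemma DForm.toCochain_add {n : ℕ} (a b : DForm X n V) :
    (a + b).toCochain = a.toCochain + b.toCochain := by
  have key : ∀ (a : DForm X n V) (s : SmoothSimplex X n), MeasureTheory.IntegrableOn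
      (fun x => a.toFun n s.extension s.isPlot_extension x
        fun i => EuclideanSpace.single i (1 : ℝ)) (stdSimp n) := by
    intro a s
    refine ContinuousOn.integrableOn_compact (isCompact_stdSimp n) (Continuous.continuousOn ?_)
    exact (ContinuousAlternatingMap.apply ℝ (Euc n) V
      fun i => EuclideanSpace.single i (1 : ℝ)).continuous.comp
      (a.smooth' n s.extension s.isPlot_extension).continuous
  funext s
  exact MeasureTheory.integral_add (key a s) (key b s)

/-- The radial contraction `(s a)ₓ(v₁,…,v_k) = ∫₀¹ t^k a_{t x}(x, v₁,…,v_k) dt` of forms. -/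
def EForm.cone {n k : ℕ} (a : EForm n (k + 1) V) : EForm n k V :=
  fun x => ∫ t in (0 : ℝ)..1, t ^ k • (a (t • x)).curryLeft x

/-- On forms on the `n`-simplex: integral of the wedge product, subtracted from the value of the cup
product of the integration cochains. -/
def cupSubWedge (β : V →L[ℝ] W →L[ℝ] U) (n : ℕ) {p q : ℕ} (h : p + q = n)
    (a : EForm n p V) (b : EForm n q W) : U :=
  β (a.pull (simpMap (frontIncl h))).simpInt (b.pull (simpMap (backIncl h))).simpInt -
    EForm.simpInt fun x => wedgeAlt β h (a x) (b x)

/-- The natural chain homotopy `B` between cup and wedge product given by the method of acyclic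
models, on forms on the `n`-simplex. It is defined recursively by
`Bₙ y = (cup - wedge) (S y) - ∑ᵢ (-1)ⁱ Bₙ₋₁ (∂ᵢ^* (S y))` on `y = a ⊗ b`, where `S = s ⊗ 1 + ε ⊗ s`
is the contraction of the tensor product of de Rham complexes induced by the radial
contraction `s`, and `ε` is evaluation of functions at the vertex `0`. -/
def cupWedgeHomotopyAux (β : V →L[ℝ] W →L[ℝ] U) :
    ∀ (n : ℕ) {p q : ℕ}, p + q = n + 1 → EForm n p V → EForm n q W → U
  | 0, _, _, _, _, _ => 0
  | n + 1, p + 1, _, h, a, b =>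
    cupSubWedge β (n + 1) (by omega) a.cone b -
      ∑ i : Fin (n + 2), (-1 : ℤ) ^ (i : ℕ) •
        cupWedgeHomotopyAux β n (by omega) (a.cone.pull (simpMap i.succAbove))
          (b.pull (simpMap i.succAbove))
  | n + 1, 0, q + 1, h, a, b =>
    cupSubWedge β (n + 1) (p := 0) (by omega) (fun _ => a 0) b.cone -
      ∑ i : Fin (n + 2), (-1 : ℤ) ^ (i : ℕ) •
        cupWedgeHomotopyAux β n (p := 0) (by omega)
          (EForm.pull (simpMap i.succAbove) fun _ => a 0) (b.cone.pull (simpMap i.succAbove))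
  | _ + 1, 0, 0, h, _, _ => absurd h (by omega)

/-- The natural chain homotopy `B` on a diffeological space, with
`δ B(a, b) + B(da, b) + (-1)^p B(a, db) = ã ∪ b̃ - (a ∧ b)~`. -/
def cupWedgeHomotopy (β : V →L[ℝ] W →L[ℝ] U) {p q n : ℕ} (h : p + q = n + 1)
    (a : DForm X p V) (b : DForm X q W) : Cochain X n U :=
  fun s => cupWedgeHomotopyAux β n h (a.toFun n s.extension s.isPlot_extension)
    (b.toFun n s.extension s.isPlot_extension)

end Cochains

section DiffCochains

variable {V : Type*} [NormedAddCommGroup V] [NormedSpace ℝ V]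

/-- Differential cochains of degree `p = k + 1`: the group `𝒞^p(q)(X; Λ)` of triples `(c, h, ω)` in
`C^p(X; Λ) × C^{p-1}(X; V) × Ω^p(X; V)`, for any `q ≤ p` (it does not depend on `q` in this range,
which is the only one that occurs in the geometric groupoid). -/
abbrev DiffCochain (Λ : Submodule ℤ V) (X : Type*) [DiffeologicalSpace X] (k : ℕ) : Type _ :=
  Cochain X (k + 1) Λ × Cochain X k V × DForm X (k + 1) V

namespace DiffCochain

variable {Λ : Submodule ℤ V} {X Y : Type*} [DiffeologicalSpace X] [DiffeologicalSpace Y] {k : ℕ}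

/-- The curvature. -/
def curv (x : DiffCochain Λ X k) : DForm X (k + 1) V := x.2.2

/-- The differential `(c, h, ω) ↦ (δc, c - ω̃ - δh, dω)`. -/
def d : DiffCochain Λ X k →+ DiffCochain Λ X (k + 1) :=
  AddMonoidHom.mk'
    (fun x => (coboundary x.1, (fun s => (x.1 s : V)) - x.2.2.toCochain - coboundary x.2.1, x.2.2.d))
    (by
      intro x y
      refine Prod.ext ?_ (Prod.ext ?_ ?_)
      · funext s
        simp [coboundary, smul_add, Finset.sum_add_distrib]
      · funext s
        simp [coboundary, smul_add, Finset.sum_add_distrib, DForm.toCochain_add]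
        abel
      · exact DForm.d_add _ _)

/-- Pullback along a smooth map. -/
def pullback (f : X → Y) (hf : DSmooth f) (x : DiffCochain Λ Y k) : DiffCochain Λ X k :=
  (fun s => x.1 (s.map f hf), fun s => x.2.1 (s.map f hf), x.2.2.pullback f hf)

end DiffCochain

/-- The lattice `ℤ ⊂ ℝ`. -/
def intLattice : Submodule ℤ ℝ := LinearMap.range (Algebra.linearMap ℤ ℝ)

/-- The dual lattice `Λ̂ = Hom(Λ, ℤ) ⊂ V̂`. -/
def dualLattice (Λ : Submodule ℤ V) : Submodule ℤ (V →L[ℝ] ℝ) where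
  carrier := {φ | ∀ l ∈ Λ, φ l ∈ intLattice}
  zero_mem' := fun l _ => by simp
  add_mem' := fun ha hb l hl => by simpa using add_mem (ha l hl) (hb l hl)
  smul_mem' := fun c φ h l hl => by simpa using intLattice.smul_mem c (h l hl)

/-- The pairing `Λ × Λ̂ → ℤ`. -/
def latticePairing {Λ : Submodule ℤ V} (l : Λ) (φ : dualLattice Λ) : intLattice :=
  ⟨(φ : V →L[ℝ] ℝ) l, φ.2 l l.2⟩

/-- The pairing `V × V̂ → ℝ`. -/
def vectorPairing (V : Type*) [NormedAddCommGroup V] [NormedSpace ℝ V] :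
    V →L[ℝ] (V →L[ℝ] ℝ) →L[ℝ] ℝ :=
  ContinuousLinearMap.apply ℝ ℝ

/-- The pairing of differential cochains: the cup product
`(c₁, h₁, ω₁) · (c₂, h₂, ω₂) = (c₁ ∪ c₂, (-1)^p c₁ ∪ h₂ + h₁ ∪ ω̃₂ + B(ω₁, ω₂), ω₁ ∧ ω₂)`, where
`p = k + 1` is the degree of the first factor, combined with the pairings `Λ × Λ̂ → ℤ` and
`V × V̂ → ℝ`. Its degree `m + 1` is the sum `(k + 1) + (l + 1)`. -/
def DiffCochain.pairing {Λ : Submodule ℤ V} {X : Type*} [DiffeologicalSpace X] {k l m : ℕ}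
    (hm : k + l + 1 = m) (x : DiffCochain Λ X k) (y : DiffCochain (dualLattice Λ) X l) :
    DiffCochain intLattice X m :=
  (cupCochain latticePairing (p := k + 1) (q := l + 1) (by omega) x.1 y.1,
    (-1 : ℤ) ^ (k + 1) • cupCochain (fun (c : Λ) h => vectorPairing V c h)
      (p := k + 1) (q := l) (by omega) x.1 y.2.1 +
      cupCochain (fun h w => vectorPairing V h w) (p := k) (q := l + 1) (by omega) x.2.1 y.2.2.toCochain +
      cupWedgeHomotopy (vectorPairing V) (by omega) x.2.2 y.2.2,
    DForm.wedge (vectorPairing V) (by omega) x.2.2 y.2.2)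

/-- The objects of the geometric groupoid `ℋ^{k+2}(X; Λ)`: the differential cocycles of degree
`k + 2`. -/
structure GeomGroupoid (Λ : Submodule ℤ V) (X : Type*) [DiffeologicalSpace X] (k : ℕ) where
  cochain : DiffCochain Λ X (k + 1)
  closed : DiffCochain.d cochain = 0

/-- A geometric morphism `x → y` in `ℋ^{k+2}(X; Λ)`: an element `α` of `𝒞^{k+1}(k+1)(X; Λ)` with
`x = y + dα`. -/
@[ext]
structure GeomGroupoid.Hom {Λ : Submodule ℤ V} {X : Type*} [DiffeologicalSpace X] {k : ℕ}
    (x y : GeomGroupoid Λ X k) where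
  cochain : DiffCochain Λ X k
  eq_add : x.cochain = y.cochain + DiffCochain.d cochain

/-- The geometric groupoid. Composition is addition of cochains. -/
instance {Λ : Submodule ℤ V} {X : Type*} [DiffeologicalSpace X] {k : ℕ} :
    CategoryTheory.Groupoid (GeomGroupoid Λ X k) where
  Hom x y := GeomGroupoid.Hom x y
  id x := ⟨0, by simp⟩
  comp f g := ⟨f.cochain + g.cochain, by rw [f.eq_add, g.eq_add, map_add]; abel⟩
  id_comp f := GeomGroupoid.Hom.ext (zero_add f.cochain)
  comp_id f := GeomGroupoid.Hom.ext (add_zero f.cochain)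
  assoc f g h := GeomGroupoid.Hom.ext (add_assoc f.cochain g.cochain h.cochain)
  inv f := ⟨-f.cochain, by rw [f.eq_add, map_neg]; abel⟩
  inv_comp f := GeomGroupoid.Hom.ext (neg_add_cancel f.cochain)
  comp_inv f := GeomGroupoid.Hom.ext (add_neg_cancel f.cochain)

end DiffCochains

section Spaces

/-- The fibre product `A ×_C B`. -/
def FibreProduct {A B C : Type*} (f : A → C) (g : B → C) : Type _ :=
  {z : A × B // f z.1 = g z.2}

namespace FibreProduct

variable {A B C : Type*} {f : A → C} {g : B → C}

/-- The first projection. -/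
def fst (z : FibreProduct f g) : A := z.1.1

/-- The second projection. -/
def snd (z : FibreProduct f g) : B := z.1.2

/-- The plots of the fibre product are the maps whose two components are plots. -/
instance [DiffeologicalSpace A] [DiffeologicalSpace B] :
    DiffeologicalSpace (FibreProduct f g) where
  plots n := {p | IsPlot (fst ∘ p) ∧ IsPlot (snd ∘ p)}
  constant_plots _ := ⟨isPlot_const, isPlot_const⟩
  plot_reparam hp hh := ⟨isPlot_reparam hp.1 hh, isPlot_reparam hp.2 hh⟩
  locality h := by
    refine ⟨DiffeologicalSpace.locality fun x => ?_, DiffeologicalSpace.locality fun x => ?_⟩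
    · obtain ⟨u, hu, hx, H⟩ := h x
      exact ⟨u, hu, hx, fun h1 h2 => (H h1 h2).1⟩
    · obtain ⟨u, hu, hx, H⟩ := h x
      exact ⟨u, hu, hx, fun h1 h2 => (H h1 h2).2⟩

variable [DiffeologicalSpace A] [DiffeologicalSpace B]

lemma smooth_fst : DSmooth (fst : FibreProduct f g → A) := fun _ _ hp => hp.1

lemma smooth_snd : DSmooth (snd : FibreProduct f g → B) := fun _ _ hp => hp.2

/-- The diagonal section `p ↦ (p, p)`. -/
def diag (f : A → C) (a : A) : FibreProduct f f := ⟨(a, a), rfl⟩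

lemma smooth_diag (f : A → C) : DSmooth (diag f) := fun _ _ hp => ⟨hp, hp⟩

end FibreProduct

/-- The diffeology of a smooth manifold: the plots are the smooth maps. -/
@[reducible]
def manifoldDiffeology {E H : Type*} [NormedAddCommGroup E] [NormedSpace ℝ E] [TopologicalSpace H]
    (I : ModelWithCorners ℝ E H) (M : Type*) [TopologicalSpace M] [ChartedSpace H M] :
    DiffeologicalSpace M where
  plots n := {p | ContMDiff 𝓘(ℝ, Euc n) I ∞ p}
  constant_plots _ := contMDiff_const
  plot_reparam hp hf := hp.comp hf.contMDiff
  locality {n p} h := by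
    intro x
    obtain ⟨u, hu, hxu, H⟩ := h x
    obtain ⟨ε, hε, hε'⟩ := Metric.isOpen_iff.mp hu x hxu
    have h1 : ContMDiff 𝓘(ℝ, Euc n) I ∞ (p ∘ OpenPartialHomeomorph.univBall x ε) := by
      refine H (f := OpenPartialHomeomorph.univBall x ε) (fun y => hε' ?_)
        OpenPartialHomeomorph.contDiff_univBall
      have := (OpenPartialHomeomorph.univBall x ε).map_source (x := y)
      rw [OpenPartialHomeomorph.univBall_target x hε] at this
      exact this (by simp)
    have h2 : ContMDiffAt 𝓘(ℝ, Euc n) 𝓘(ℝ, Euc n) ∞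
        (OpenPartialHomeomorph.univBall x ε).symm x :=
      ((OpenPartialHomeomorph.contDiffOn_univBall_symm (n := ⊤) (c := x) (r := ε)).contDiffAt
        (Metric.ball_mem_nhds x hε)).contMDiffAt
    refine ((h1 _).comp x h2).congr_of_eventuallyEq ?_
    filter_upwards [Metric.ball_mem_nhds x hε] with y hy
    rw [← OpenPartialHomeomorph.univBall_target x hε] at hy
    simp [OpenPartialHomeomorph.right_inv _ hy]

/-- The diffeology of the smooth manifold `M` is the one whose plots are the smooth maps. -/
class IsManifoldDiffeology {E H : Type*} [NormedAddCommGroup E] [NormedSpace ℝ E]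
    [TopologicalSpace H] (I : ModelWithCorners ℝ E H) (M : Type*) [TopologicalSpace M]
    [ChartedSpace H M] [DiffeologicalSpace M] : Prop where
  isPlot_iff : ∀ {n : ℕ} {p : Euc n → M}, IsPlot p ↔ ContMDiff 𝓘(ℝ, Euc n) I ∞ p

theorem isManifoldDiffeology_manifoldDiffeology {E H : Type*} [NormedAddCommGroup E] [NormedSpace ℝ E] [TopologicalSpace H]
    (I : ModelWithCorners ℝ E H) (M : Type*) [TopologicalSpace M] [ChartedSpace H M] :
    @IsManifoldDiffeology _ _ _ _ _ I M _ _ (manifoldDiffeology I M) :=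
  letI := manifoldDiffeology I M
  ⟨Iff.rfl⟩

end Spaces

section Bundles

variable {V : Type*} [NormedAddCommGroup V] [NormedSpace ℝ V]

/-- A principal bundle with connection `E → B` for the torus `V / Λ`: a smooth free action whose
orbits are the fibres of `proj`, with smooth division map, such that `proj` has local sections
along plots, together with a connection `1`-form. When `B` is a manifold, this is a
locally trivial smooth principal bundle. -/
structure TorusBundle (Λ : Submodule ℤ V) (E B : Type*) [DiffeologicalSpace E]
    [DiffeologicalSpace B] [AddAction (V ⧸ Λ) E] where
  proj : E → B
  smooth_proj : DSmooth proj
  /-- The action `V / Λ × E → E` is smooth. -/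
  smooth_vadd : ∀ {n : ℕ} {v : Euc n → V} {e : Euc n → E}, ContDiff ℝ ∞ v → IsPlot e →
    IsPlot fun u => (Submodule.Quotient.mk (v u) : V ⧸ Λ) +ᵥ e u
  proj_vadd : ∀ (t : V ⧸ Λ) (e : E), proj (t +ᵥ e) = proj e
  free : ∀ (t : V ⧸ Λ) (e : E), t +ᵥ e = e → t = 0
  /-- The action is transitive on the fibres, and the division map
  `E ×_B E → V / Λ` is smooth. -/
  exists_vadd_eq : ∀ {n : ℕ} {e e' : Euc n → E}, IsPlot e → IsPlot e' →
    (∀ u, proj (e u) = proj (e' u)) → ∀ u₀, ∃ v : Euc n → V, ContDiff ℝ ∞ v ∧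
      ∀ᶠ u in 𝓝 u₀, e' u = (Submodule.Quotient.mk (v u) : V ⧸ Λ) +ᵥ e u
  /-- The projection is surjective, with local sections along plots. -/
  exists_local_lift : ∀ {n : ℕ} {b : Euc n → B}, IsPlot b → ∀ u₀, ∃ e : Euc n → E, IsPlot e ∧
    ∀ᶠ u in 𝓝 u₀, proj (e u) = b u
  /-- The connection form. -/
  conn : DForm E 1 V
  /-- Invariance of the connection form and its normalisation on fundamental vector fields. -/
  conn_vadd : ∀ {n : ℕ} {v : Euc n → V} {e : Euc n → E} (hv : ContDiff ℝ ∞ v) (he : IsPlot e)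
    (u : Euc n) (w : Fin 1 → Euc n),
    conn.toFun n _ (smooth_vadd hv he) u w = conn.toFun n e he u w + fderiv ℝ v u (w 0)

lemma TorusBundle.smooth_translate {Λ : Submodule ℤ V} {E B : Type*} [DiffeologicalSpace E]
    [DiffeologicalSpace B] [AddAction (V ⧸ Λ) E] (Q : TorusBundle Λ E B) (t : V ⧸ Λ) :
    DSmooth fun e : E => t +ᵥ e := by
  obtain ⟨v, rfl⟩ := Submodule.Quotient.mk_surjective _ t
  exact fun _ _ hp => Q.smooth_vadd contDiff_const hp

/-- The cocycle `c` on `B` represents the principal bundle with connection `E → B`: there is a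
geometric trivialisation `a` of the pullback of `c` to `E` with curvature the connection form, such
that the function `-h mod Λ` to `V / Λ` defined by the middle component `h` of `a` is equivariant.
Pulling `a` back along local sections of `E` identifies these with the local geometric
trivialisations of `c` up to boundaries, compatibly with the action of `V / Λ`-valued functions and
with the connection. -/
def TorusBundle.IsRepresentedBy {Λ : Submodule ℤ V} {E B : Type*} [DiffeologicalSpace E]
    [DiffeologicalSpace B] [AddAction (V ⧸ Λ) E] (Q : TorusBundle Λ E B)
    (c : DiffCochain Λ B 1) : Prop :=
  ∃ a : DiffCochain Λ E 0, a.d = c.pullback Q.proj Q.smooth_proj ∧ a.curv = Q.conn ∧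
    ∀ (v : V) (e : E),
      a.2.1 (SmoothSimplex.point ((Submodule.Quotient.mk v : V ⧸ Λ) +ᵥ e)) + v -
        a.2.1 (SmoothSimplex.point e) ∈ Λ

/-- A principal torus bundle with connection `E → B` to be used as target of classifying maps, such
as the universal bundle `ET → BT`, with the data fixed on it once and for all: a differential
cocycle `c` representing it, and a geometric trivialisation `α` of the pullback of `c` to `E` with
invariant curvature. Universality is not demanded, so every model of `ET → BT`, including
finite-dimensional approximations, is allowed. -/
structure ModelBundle (Λ : Submodule ℤ V) (E B : Type*) [DiffeologicalSpace E]
    [DiffeologicalSpace B] [AddAction (V ⧸ Λ) E] where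
  bundle : TorusBundle Λ E B
  c : DiffCochain Λ B 1
  c_closed : c.d = 0
  represents : bundle.IsRepresentedBy c
  α : DiffCochain Λ E 0
  d_α : α.d = c.pullback bundle.proj bundle.smooth_proj
  curv_invariant : ∀ t : V ⧸ Λ,
    α.curv.pullback (fun e => t +ᵥ e) (bundle.smooth_translate t) = α.curv

/-- Classifying maps adapted to the connections. -/
structure ClassifyingMaps {Λ : Submodule ℤ V} {E B P X : Type*} [DiffeologicalSpace E]
    [DiffeologicalSpace B] [DiffeologicalSpace P] [DiffeologicalSpace X] [AddAction (V ⧸ Λ) E]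
    [AddAction (V ⧸ Λ) P] (U : ModelBundle Λ E B) (Q : TorusBundle Λ P X) where
  base : X → B
  smooth_base : DSmooth base
  total : P → E
  smooth_total : DSmooth total
  comm : ∀ p, U.bundle.proj (total p) = base (Q.proj p)
  equivariant : ∀ (t : V ⧸ Λ) (p : P), total (t +ᵥ p) = t +ᵥ total p
  adapted : U.bundle.conn.pullback total smooth_total = Q.conn

namespace ClassifyingMaps

variable {Λ : Submodule ℤ V} {E B P X : Type*} [DiffeologicalSpace E]
    [DiffeologicalSpace B] [DiffeologicalSpace P] [DiffeologicalSpace X] [AddAction (V ⧸ Λ) E]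
    [AddAction (V ⧸ Λ) P] {U : ModelBundle Λ E B} {Q : TorusBundle Λ P X}

/-- The object of `ℋ²(X; Λ)` determined by the bundle: the pullback of the cocycle `c`. -/
def object (F : ClassifyingMaps U Q) : DiffCochain Λ X 1 :=
  U.c.pullback F.base F.smooth_base

/-- The geometric trivialisation of `π^*P ∈ ℋ²(P; Λ)` furnished by the diagonal section of the
pullback bundle `P ×_X P → P` (with bundle coordinate in the second factor). -/
def diagonalTrivialisation (F : ClassifyingMaps U Q) : DiffCochain Λ P 0 :=
  (U.α.pullback (F.total ∘ FibreProduct.snd (f := Q.proj) (g := Q.proj))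
    (F.smooth_total.comp FibreProduct.smooth_snd)).pullback
    (FibreProduct.diag Q.proj) (FibreProduct.smooth_diag Q.proj)

end ClassifyingMaps

/-- Data of a differential `T`-duality pair over `X`: principal `V / Λ` and `V̂ / Λ̂` bundles with connection
and classifying maps, and a geometric trivialisation `σ` of the product of their objects. -/
structure TDualityPair {Λ : Submodule ℤ V} {E B E' B' : Type*}
    [DiffeologicalSpace E] [DiffeologicalSpace B] [AddAction (V ⧸ Λ) E]
    [DiffeologicalSpace E'] [DiffeologicalSpace B'] [AddAction ((V →L[ℝ] ℝ) ⧸ dualLattice Λ) E']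
    (U : ModelBundle Λ E B) (U' : ModelBundle (dualLattice Λ) E' B')
    (X P P' : Type*) [DiffeologicalSpace X] [DiffeologicalSpace P] [DiffeologicalSpace P']
    [AddAction (V ⧸ Λ) P] [AddAction ((V →L[ℝ] ℝ) ⧸ dualLattice Λ) P'] where
  bundle : TorusBundle Λ P X
  dualBundle : TorusBundle (dualLattice Λ) P' X
  classifying : ClassifyingMaps U bundle
  dualClassifying : ClassifyingMaps U' dualBundle
  σ : DiffCochain intLattice X 2
  d_σ : σ.d = classifying.object.pairing rfl dualClassifying.object

namespace TDualityPair

variable {Λ : Submodule ℤ V} {E B E' B' : Type*}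
    [DiffeologicalSpace E] [DiffeologicalSpace B] [AddAction (V ⧸ Λ) E]
    [DiffeologicalSpace E'] [DiffeologicalSpace B'] [AddAction ((V →L[ℝ] ℝ) ⧸ dualLattice Λ) E']
    {U : ModelBundle Λ E B} {U' : ModelBundle (dualLattice Λ) E' B'}
    {X P P' : Type*} [DiffeologicalSpace X] [DiffeologicalSpace P] [DiffeologicalSpace P']
    [AddAction (V ⧸ Λ) P] [AddAction ((V →L[ℝ] ℝ) ⧸ dualLattice Λ) P']

/-- `δ_P`, of degree `1` on `P`. -/
def δ (D : TDualityPair U U' X P P') : DiffCochain Λ P 0 :=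
  D.classifying.diagonalTrivialisation

/-- `δ̂_P̂`, of degree `1` on `P̂`. -/
def δ' (D : TDualityPair U U' X P P') : DiffCochain (dualLattice Λ) P' 0 :=
  D.dualClassifying.diagonalTrivialisation

/-- The canonical twist `τ = π^*σ - δ_P · π^*P̂` on `P`. -/
def τ (D : TDualityPair U U' X P P') : DiffCochain intLattice P 2 :=
  D.σ.pullback D.bundle.proj D.bundle.smooth_proj -
    D.δ.pairing rfl
      (D.dualClassifying.object.pullback D.bundle.proj D.bundle.smooth_proj)

/-- The canonical twist `τ̂ = π̂^*σ - π̂^*P · δ̂_P̂` on `P̂`. -/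
def τ' (D : TDualityPair U U' X P P') : DiffCochain intLattice P' 2 :=
  D.σ.pullback D.dualBundle.proj D.dualBundle.smooth_proj -
    (D.classifying.object.pullback D.dualBundle.proj D.dualBundle.smooth_proj).pairing rfl D.δ'

/-- The fibre product `P ×_X P̂`. -/
abbrev Corr (D : TDualityPair U U' X P P') : Type _ :=
  FibreProduct D.bundle.proj D.dualBundle.proj

/-- The product `δ_P · δ̂_P̂`, of degree `2` on `P ×_X P̂`. -/
def δδ' (D : TDualityPair U U' X P P') : DiffCochain intLattice D.Corr 1 :=
  (D.δ.pullback FibreProduct.fst FibreProduct.smooth_fst).pairing rfl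
    (D.δ'.pullback FibreProduct.snd FibreProduct.smooth_snd)

end TDualityPair

end Bundles

end

/-! The theorem is formal once the product of differential cochains satisfies the Leibniz rule `d (x
· y) = dx · y + (-1)^|x| x · dy` (`DiffCochain.d_pairing`) and pullbacks respect `d` and products.
Indeed `dδ_P = π^*P`, because `δ_P` is the pullback of `α` along the classifying map, and the same
holds for the dual bundle. The objects `P` and `P̂` are closed, so `d(π^*σ) = π^*P · π^*P̂ = d(δ_P ·
π^*P̂)`, whence `dτ = 0`; the argument for `τ̂` is symmetric. On the fibre product the two pullbacks
of `σ` from `X` coincide, and since `δ_P` has degree one, `d(δ_P · δ̂) = P · δ̂ - δ_P · P̂`, which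
is exactly `τ - τ̂`.

The work lies in the Leibniz rule. Its integral component is the combinatorial Leibniz rule of the
cup product (`sum_faces_cup`), and its curvature component the one of the wedge product
(`extDeriv_wedgeAlt`). The middle component needs in addition Stokes' theorem
(`EForm.simpInt_extDeriv`) and the homotopy formula for `B` (`cupWedgeHomotopyAux_extDeriv`).

Stokes and the homotopy formula both rest on the radial contraction of forms. Integrating a top form
over a simplex amounts to integrating its contraction over the face opposite to the vertex `0`
(`EForm.simpInt_succ`); with the Poincaré lemma this yields Stokes by induction on the dimension.

For the homotopy formula let `T` be cup minus wedge, `∂` the alternating sum over faces, `D` the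
differential of a tensor product of forms and `S` its contraction, so that `SD = 1 - DS` in positive
degree. By Stokes and the two Leibniz rules `T D = ∂ T`. From the recursion `B = T S - ∂ B S` one
finds `B D y = T y - T D S y - ∂ B y + ∂ B D S y`; by induction and `∂ ∂ = 0`, `∂ B D S y = ∂ T S y
= T D S y`, so `B D + ∂ B = T`.

Finally, a singular simplex carries forms only through a chosen smooth extension. Everything depends
only on values on the closed simplex, where any two extensions give the same form; this makes the
constructions natural and compatible with faces. -/

noncomputable section

/-! ### Antisymmetrisation over the symmetric group. -/

section AltSum

variable {M U : Type*} [AddCommGroup U]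

/-- The antisymmetrisation of a function of `n` variables. -/
def altSum {n : ℕ} (F : (Fin n → M) → U) (v : Fin n → M) : U :=
  ∑ σ : Equiv.Perm (Fin n), Equiv.Perm.sign σ • F (v ∘ σ)

lemma altSum_perm {n : ℕ} (F : (Fin n → M) → U) (τ : Equiv.Perm (Fin n)) (v : Fin n → M) :
    altSum (fun w => F (w ∘ τ)) v = Equiv.Perm.sign τ • altSum F v := by
  unfold altSum
  rw [Finset.smul_sum]
  refine Fintype.sum_equiv (Equiv.mulRight τ) _ _ fun σ => ?_
  rw [Equiv.coe_mulRight, Equiv.Perm.sign_mul, smul_smul, mul_left_comm, Int.units_mul_self,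
    mul_one]
  rfl

lemma altSum_sum {ι : Type*} (s : Finset ι) {n : ℕ} (F : ι → (Fin n → M) → U) (v : Fin n → M) :
    altSum (fun w => ∑ i ∈ s, F i w) v = ∑ i ∈ s, altSum (F i) v := by
  unfold altSum
  simp only [Finset.smul_sum]
  exact Finset.sum_comm

lemma altSum_zsmul {n : ℕ} (c : ℤ) (F : (Fin n → M) → U) (v : Fin n → M) :
    altSum (fun w => c • F w) v = c • altSum F v := by
  unfold altSum
  simp only [Finset.smul_sum, smul_comm _ c]

/-- A permutation of `n + 1` letters amounts to the image `i` of `0` together with a permutation of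
the remaining letters. This is the bridge between the sum over permutations in the wedge product and
the sum over slots in the exterior derivative. -/
lemma altSum_succ {n : ℕ} (G : M → (Fin n → M) → U) (v : Fin (n + 1) → M) :
    altSum (fun w => G (w 0) fun j => w j.succ) v =
      ∑ i : Fin (n + 1), (-1 : ℤ) ^ (i : ℕ) • altSum (G (v i)) fun j => v (i.succAbove j) := by
  -- The second factor fixes `0` and permutes the successors; the cycle then sends `0` to `i` and
  -- the successors in order to the complement of `i`, contributing the sign `(-1)^i`.
  let e : Fin (n + 1) × Equiv.Perm (Fin n) → Equiv.Perm (Fin (n + 1)) := fun x =>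
    x.1.cycleRange.symm * Equiv.Perm.decomposeFin.symm (0, x.2)
  have e0 : ∀ x, e x 0 = x.1 := fun x => by simp [e]
  have es : ∀ x j, e x (Fin.succ j) = x.1.succAbove (x.2 j) := fun x j => by
    simp [e, Fin.cycleRange_symm_succ]
  have he : Function.Bijective e := by
    rw [Fintype.bijective_iff_injective_and_card]
    refine ⟨fun x y h => ?_, ?_⟩
    · have h1 : x.1 = y.1 := by rw [← e0 x, ← e0 y, h]
      refine Prod.ext h1 (Equiv.ext fun j => ?_)
      have := es x j
      rw [h, es y j, h1] at this
      exact (Fin.succAbove_right_injective this).symm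
    · simp [Fintype.card_perm, Nat.factorial_succ]
  unfold altSum
  rw [← he.sum_comp, Fintype.sum_prod_type]
  refine Finset.sum_congr rfl fun i _ => ?_
  rw [Finset.smul_sum]
  refine Finset.sum_congr rfl fun τ _ => ?_
  have hs : Equiv.Perm.sign (e (i, τ)) = (-1) ^ (i : ℕ) * Equiv.Perm.sign τ := by
    simp [e, Equiv.Perm.sign_mul, Equiv.Perm.decomposeFin.symm_sign]
  have hfun : (fun j : Fin n => (v ∘ e (i, τ)) j.succ) = (fun j => v (i.succAbove j)) ∘ τ := by
    funext j; simp [es]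
  beta_reduce
  rw [hfun, hs, mul_smul, Function.comp_apply, e0]
  simp [Units.smul_def]

end AltSum

/-! ### The Leibniz rule for the wedge product of forms. -/

section WedgeLeibniz

variable {V W U : Type*} [NormedAddCommGroup V] [NormedSpace ℝ V]
  [NormedAddCommGroup W] [NormedSpace ℝ W] [NormedAddCommGroup U] [NormedSpace ℝ U]

lemma wedgeAlt_eq_altSum (β : V →L[ℝ] W →L[ℝ] U) {m p q n : ℕ} (h : p + q = n)
    (a : Euc m [⋀^Fin p]→L[ℝ] V) (b : Euc m [⋀^Fin q]→L[ℝ] W) (v : Fin n → Euc m) :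
    wedgeAlt β h a b v = ((p.factorial * q.factorial : ℝ)⁻¹) •
      altSum (fun w => β (a fun i => w (Fin.cast h (Fin.castAdd q i)))
        (b fun j => w (Fin.cast h (Fin.natAdd p j)))) v :=
  wedgeAlt_apply β h a b v

/-- This is `altSum_succ` with the differentiation direction as the distinguished slot. One of `L`
and `R` will be constant and the other a derivative, giving the two halves of the Leibniz rule. -/
lemma sum_neg_one_pow_wedgeAlt (β : V →L[ℝ] W →L[ℝ] U) {m p q n : ℕ} (h : p + q = n)
    (F : Euc m → (Fin n → Euc m) → U) (c : ℝ)
    (L : Euc m → Euc m [⋀^Fin p]→L[ℝ] V) (R : Euc m → Euc m [⋀^Fin q]→L[ℝ] W)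
    (hc : c = (p.factorial * q.factorial : ℝ)⁻¹)
    (hF : ∀ x w, F x w = β (L x fun i => w (Fin.cast h (Fin.castAdd q i)))
        (R x fun j => w (Fin.cast h (Fin.natAdd p j)))) (v : Fin (n + 1) → Euc m) :
    ∑ i : Fin (n + 1), (-1 : ℤ) ^ (i : ℕ) • wedgeAlt β h (L (v i)) (R (v i)) (i.removeNth v) =
      c • altSum (fun w => F (w 0) fun j => w j.succ) v := by
  subst hc
  rw [altSum_succ F, Finset.smul_sum]
  refine Finset.sum_congr rfl fun i _ => ?_
  rw [wedgeAlt_eq_altSum, smul_comm]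
  obtain rfl : F = _ := funext₂ hF
  rfl

lemma sum_wedgeAlt_left (β : V →L[ℝ] W →L[ℝ] U) {m p q n : ℕ} (h : p + q = n)
    (L : Euc m →L[ℝ] Euc m [⋀^Fin p]→L[ℝ] V) (b : Euc m [⋀^Fin q]→L[ℝ] W)
    (v : Fin (n + 1) → Euc m) :
    ∑ i : Fin (n + 1), (-1 : ℤ) ^ (i : ℕ) • wedgeAlt β h (L (v i)) b (i.removeNth v) =
      wedgeAlt β (p := p + 1) (by omega)
        (ContinuousAlternatingMap.alternatizeUncurryFin L) b v := by
  subst h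
  rw [sum_neg_one_pow_wedgeAlt β rfl (fun x w => β (L x fun i => w (Fin.castAdd q i))
      (b fun j => w (Fin.natAdd p j))) _ (fun x => L x) (fun _ => b) rfl (fun _ _ => rfl),
    wedgeAlt_eq_altSum]
  simp only [ContinuousAlternatingMap.alternatizeUncurryFin_apply, map_sum, _root_.sum_apply,
    altSum_sum]
  -- All `p + 1` summands of the alternatised derivative have the same antisymmetrisation: the cycle
  -- moving slot `i` to the front has sign `(-1)^i`, which cancels the sign of the summand.
  have key : ∀ i : Fin (p + 1), altSum (fun w : Fin (p + q + 1) → Euc m =>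
      β ((-1) ^ (i : ℕ) • L (w (Fin.cast (by omega) (Fin.castAdd q i)))
        (i.removeNth fun i => w (Fin.cast (by omega) (Fin.castAdd q i))))
      (b fun j => w (Fin.cast (by omega) (Fin.natAdd (p + 1) j)))) v =
      altSum (fun w => β (L (w 0) fun i => w (Fin.castAdd q i).succ)
        (b fun j => w (Fin.natAdd p j).succ)) v := by
    intro i
    set i' : Fin (p + q + 1) := Fin.cast (by omega) (Fin.castAdd q i) with hi'
    have hi : (i' : ℕ) = i := rfl
    have h1 := altSum_perm (fun w : Fin (p + q + 1) → Euc m =>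
      β (L (w 0) fun i => w (Fin.castAdd q i).succ)
        (b fun j => w (Fin.natAdd p j).succ)) i'.cycleRange.symm v
    simp only [Function.comp_apply, Fin.cycleRange_symm_zero, Fin.cycleRange_symm_succ,
      Equiv.Perm.sign_symm, Fin.sign_cycleRange] at h1
    have h2 : ∀ w : Fin (p + q + 1) → Euc m, β ((-1) ^ (i : ℕ) • L (w i')
        (i.removeNth fun i => w (Fin.cast (by omega) (Fin.castAdd q i))))
        (b fun j => w (Fin.cast (by omega) (Fin.natAdd (p + 1) j))) =
        (-1 : ℤ) ^ (i : ℕ) • β (L (w i') fun k => w (i'.succAbove (Fin.castAdd q k)))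
        (b fun j => w (i'.succAbove (Fin.natAdd p j))) := by
      intro w
      have e1 : (i.removeNth fun i => w (Fin.cast (by omega) (Fin.castAdd q i))) =
          fun k => w (i'.succAbove (Fin.castAdd q k)) := by
        funext k
        simp only [Fin.removeNth]
        congr 1
        ext
        simp only [Fin.val_cast, Fin.val_castAdd, Fin.succAbove, Fin.lt_def, hi, Fin.val_castSucc]
        split_ifs <;> simp
      have e2 : (fun j => w (Fin.cast (by omega) (Fin.natAdd (p + 1) j))) =
          fun j => w (i'.succAbove (Fin.natAdd p j)) := by
        funext j
        congr 1
        ext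
        have := i.2
        simp only [Fin.val_cast, Fin.val_natAdd, Fin.succAbove, Fin.lt_def, hi, Fin.val_castSucc]
        split_ifs
        · omega
        · simp; omega
      rw [e1, e2]
      rcases Nat.even_or_odd (i : ℕ) with h | h <;> simp [h.neg_one_pow]
    refine (congrArg (altSum · v) (funext h2)).trans ?_
    simp only [altSum_zsmul, h1, hi]
    rcases Nat.even_or_odd (i : ℕ) with h | h <;> simp [h.neg_one_pow]
  -- The `p + 1` equal summands turn the normalisation `1 / ((p + 1)! q!)` into `1 / (p! q!)`.
  rw [Finset.sum_congr rfl fun i _ => key i, Finset.sum_const, Finset.card_univ, Fintype.card_fin,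
    ← Nat.cast_smul_eq_nsmul ℝ, smul_smul]
  congr 1
  rw [Nat.factorial_succ]
  have h1 := Nat.factorial_ne_zero p
  have h2 := Nat.factorial_ne_zero q
  push_cast
  field_simp

/-- Here the distinguished slot is `p + i`. Moving it to the front costs `(-1)^(p + i)`, so after
cancelling `(-1)^i` the sign `(-1)^p` of the Leibniz rule survives. -/
lemma sum_wedgeAlt_right (β : V →L[ℝ] W →L[ℝ] U) {m p q n : ℕ} (h : p + q = n)
    (a : Euc m [⋀^Fin p]→L[ℝ] V) (L : Euc m →L[ℝ] Euc m [⋀^Fin q]→L[ℝ] W)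
    (v : Fin (n + 1) → Euc m) :
    ∑ i : Fin (n + 1), (-1 : ℤ) ^ (i : ℕ) • wedgeAlt β h a (L (v i)) (i.removeNth v) =
      (-1 : ℤ) ^ p • wedgeAlt β (q := q + 1) (by omega) a
        (ContinuousAlternatingMap.alternatizeUncurryFin L) v := by
  subst h
  rw [sum_neg_one_pow_wedgeAlt β rfl (fun x w => β (a fun i => w (Fin.castAdd q i))
      (L x fun j => w (Fin.natAdd p j))) _ (fun _ => a) (fun x => L x) rfl (fun _ _ => rfl),
    wedgeAlt_eq_altSum]
  simp only [ContinuousAlternatingMap.alternatizeUncurryFin_apply, map_sum, altSum_sum]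
  have key : ∀ i : Fin (q + 1), altSum (fun w : Fin (p + q + 1) → Euc m =>
      β (a fun k => w (Fin.cast (by omega) (Fin.castAdd (q + 1) k)))
      ((-1) ^ (i : ℕ) • L (w (Fin.cast (by omega) (Fin.natAdd p i)))
        (i.removeNth fun i => w (Fin.cast (by omega) (Fin.natAdd p i))))) v =
      (-1 : ℤ) ^ p • altSum (fun w => β (a fun i => w (Fin.castAdd q i).succ)
        (L (w 0) fun j => w (Fin.natAdd p j).succ)) v := by
    intro i
    set i' : Fin (p + q + 1) := Fin.cast (by omega) (Fin.natAdd p i) with hi'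
    have hi : (i' : ℕ) = p + i := rfl
    have h1 := altSum_perm (fun w : Fin (p + q + 1) → Euc m =>
      β (a fun i => w (Fin.castAdd q i).succ)
        (L (w 0) fun j => w (Fin.natAdd p j).succ)) i'.cycleRange.symm v
    simp only [Function.comp_apply, Fin.cycleRange_symm_zero, Fin.cycleRange_symm_succ,
      Equiv.Perm.sign_symm, Fin.sign_cycleRange] at h1
    have h2 : ∀ w : Fin (p + q + 1) → Euc m,
        β (a fun k => w (Fin.cast (by omega) (Fin.castAdd (q + 1) k))) ((-1) ^ (i : ℕ) • L (w i')
        (i.removeNth fun i => w (Fin.cast (by omega) (Fin.natAdd p i)))) =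
        (-1 : ℤ) ^ (i : ℕ) • β (a fun k => w (i'.succAbove (Fin.castAdd q k)))
        (L (w i') fun j => w (i'.succAbove (Fin.natAdd p j))) := by
      intro w
      have e1 : (i.removeNth fun i => w (Fin.cast (by omega) (Fin.natAdd p i))) =
          fun k => w (i'.succAbove (Fin.natAdd p k)) := by
        funext k
        simp only [Fin.removeNth]
        congr 1
        ext
        simp only [Fin.val_cast, Fin.val_natAdd, Fin.succAbove, Fin.lt_def, hi, Fin.val_castSucc]
        split_ifs <;> simp <;> omega
      have e2 : (fun k => w (Fin.cast (by omega) (Fin.castAdd (q + 1) k))) =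
          fun j => w (i'.succAbove (Fin.castAdd q j)) := by
        funext j
        congr 1
        ext
        have := j.2
        simp only [Fin.val_cast, Fin.val_castAdd, Fin.succAbove, Fin.lt_def, hi, Fin.val_castSucc]
        split_ifs
        · simp
        · omega
      rw [e1, e2]
      rcases Nat.even_or_odd (i : ℕ) with h | h <;> simp [h.neg_one_pow]
    simp only [h2, altSum_zsmul, h1, hi]
    rcases Nat.even_or_odd (i : ℕ) with h | h <;> rcases Nat.even_or_odd p with h' | h' <;>
      simp [pow_add, h.neg_one_pow, h'.neg_one_pow]
  rw [Finset.sum_congr rfl fun i _ => key i, Finset.sum_const, Finset.card_univ, Fintype.card_fin,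
    ← Nat.cast_smul_eq_nsmul ℝ, smul_smul, smul_comm ((-1 : ℤ) ^ p), smul_smul, ← mul_pow]
  simp only [mul_neg, mul_one, neg_neg, one_pow, one_smul]
  congr 1
  rw [Nat.factorial_succ]
  have h1 := Nat.factorial_ne_zero p
  have h2 := Nat.factorial_ne_zero q
  push_cast
  field_simp

lemma extDeriv_wedgeAlt (β : V →L[ℝ] W →L[ℝ] U) {m p q n : ℕ} (h : p + q = n)
    {a : EForm m p V} {b : EForm m q W} (ha : ContDiff ℝ ∞ a) (hb : ContDiff ℝ ∞ b) (x : Euc m) :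
    extDeriv (fun y => wedgeAlt β h (a y) (b y)) x =
      wedgeAlt β (p := p + 1) (by omega) (extDeriv a x) (b x) +
        (-1 : ℤ) ^ p • wedgeAlt β (q := q + 1) (by omega) (a x) (extDeriv b x) := by
  have hda := (ha.differentiable (by simp) x).hasFDerivAt
  have hdb := (hb.differentiable (by simp) x).hasFDerivAt
  have hd := (wedgeCLM β h (m := m)).hasFDerivAt_of_bilinear hda hdb
  ext v
  have : extDeriv (fun y => wedgeAlt β h (a y) (b y)) x =
      ContinuousAlternatingMap.alternatizeUncurryFin
        (fderiv ℝ (fun y => wedgeAlt β h (a y) (b y)) x) := rfl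
  rw [this, ContinuousAlternatingMap.alternatizeUncurryFin_apply]
  erw [hd.fderiv]
  rw [ContinuousAlternatingMap.add_apply]
  have h1 := sum_wedgeAlt_left β h (fderiv ℝ a x) (b x) v
  have h2 := sum_wedgeAlt_right β h (a x) (fderiv ℝ b x) v
  have h3 : ((-1 : ℤ) ^ p • wedgeAlt β (q := q + 1) (n := n + 1) (by omega) (a x)
    (extDeriv b x)) v = (-1 : ℤ) ^ p • (wedgeAlt β (q := q + 1) (n := n + 1) (by omega) (a x)
    (extDeriv b x) v) := rfl
  rw [h3]
  erw [← h1, ← h2]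
  rw [← Finset.sum_add_distrib]
  refine Finset.sum_congr rfl fun i _ => ?_
  rw [← smul_add]
  congr 1
  exact add_comm _ _

end WedgeLeibniz

/-! ### Smoothness of integrals depending on a parameter. -/

section ParametricIntegral

variable {E : Type} {F : Type*} [NormedAddCommGroup E] [NormedSpace ℝ E] [ProperSpace E]
  [NormedAddCommGroup F] [NormedSpace ℝ F]

lemma hasFDerivAt_intervalIntegral_of_contDiff {G : E × ℝ → F} (hG : ContDiff ℝ ∞ G) (x : E) :
    HasFDerivAt (fun y => ∫ t in (0 : ℝ)..1, G (y, t))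
      (∫ t in (0 : ℝ)..1, (fderiv ℝ G (x, t)).comp (ContinuousLinearMap.inl ℝ E ℝ)) x := by
  have hc : Continuous fun z : E × ℝ =>
      (fderiv ℝ G z).comp (ContinuousLinearMap.inl ℝ E ℝ) :=
    (hG.continuous_fderiv (by simp)).clm_comp continuous_const
  -- Closed balls in `E` are compact, so the derivative is bounded near `x` uniformly in `t`; the
  -- constant bound is the dominating function.
  obtain ⟨C, hC⟩ := ((isCompact_closedBall x 1).prod (isCompact_Icc (a := (0 : ℝ)) (b := 1))
    ).exists_bound_of_continuousOn hc.continuousOn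
  refine intervalIntegral.hasFDerivAt_integral_of_dominated_of_fderiv_le
    (F' := fun y t => (fderiv ℝ G (y, t)).comp (ContinuousLinearMap.inl ℝ E ℝ))
    (s := Metric.closedBall x 1) (bound := fun _ => C) (Metric.closedBall_mem_nhds x one_pos)
    ?_ ?_ ?_ ?_ ?_ ?_
  · exact Filter.Eventually.of_forall fun y =>
      (hG.continuous.comp (by fun_prop : Continuous fun t : ℝ => (y, t))).aestronglyMeasurable
  · exact (hG.continuous.comp
      (by fun_prop : Continuous fun t : ℝ => (x, t))).intervalIntegrable _ _
  · exact (hc.comp (by fun_prop : Continuous fun t : ℝ => (x, t))).aestronglyMeasurable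
  · refine Filter.Eventually.of_forall fun t ht y hy => hC (y, t) ⟨hy, ?_⟩
    rw [Set.uIoc_of_le zero_le_one] at ht
    exact ⟨ht.1.le, ht.2⟩
  · exact intervalIntegrable_const
  · refine Filter.Eventually.of_forall fun t _ y _ => ?_
    exact (hG.differentiable (by simp) (y, t)).hasFDerivAt.comp y (hasFDerivAt_prodMk_left y t)

/-- The derivative is again an integral of the same kind with values in `E →L[ℝ] F`, so the
induction on the order has to vary the target `F`. -/
lemma contDiff_intervalIntegral {G : E × ℝ → F} (hG : ContDiff ℝ ∞ G) :
    ContDiff ℝ ∞ fun y => ∫ t in (0 : ℝ)..1, G (y, t) := by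
  refine contDiff_infty.2 fun k => ?_
  induction k generalizing F with
  | zero =>
    exact contDiff_zero.2 (continuous_iff_continuousAt.2 fun x =>
      (hasFDerivAt_intervalIntegral_of_contDiff hG x).continuousAt)
  | succ k ih =>
    have h : ContDiff ℝ ((k : WithTop ℕ∞) + 1) fun y => ∫ t in (0 : ℝ)..1, G (y, t) := by
      refine contDiff_succ_iff_fderiv.2
        ⟨fun x => (hasFDerivAt_intervalIntegral_of_contDiff hG x).differentiableAt,
        fun h => absurd h (by simp), ?_⟩
      have : (fderiv ℝ fun y => ∫ t in (0 : ℝ)..1, G (y, t)) = fun x =>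
          ∫ t in (0 : ℝ)..1, (fderiv ℝ G (x, t)).comp (ContinuousLinearMap.inl ℝ E ℝ) :=
        funext fun x => (hasFDerivAt_intervalIntegral_of_contDiff hG x).fderiv
      rw [this]
      exact ih (G := fun z => (fderiv ℝ G z).comp (ContinuousLinearMap.inl ℝ E ℝ))
        ((hG.fderiv_right (m := ∞) (by simp)).clm_comp contDiff_const)
    exact_mod_cast h

end ParametricIntegral

/-! ### The radial contraction and the Poincaré lemma on Euclidean space. -/

namespace EForm

variable {V : Type*} [NormedAddCommGroup V] [NormedSpace ℝ V] {n k : ℕ}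

lemma contDiff_extDeriv {a : EForm n k V} (ha : ContDiff ℝ ∞ a) : ContDiff ℝ ∞ (extDeriv a) := by
  change ContDiff ℝ ∞ fun x => ContinuousAlternatingMap.alternatizeUncurryFinCLM ℝ (Euc n) V
    (fderiv ℝ a x)
  exact (ContinuousLinearMap.contDiff _).comp (ha.fderiv_right (m := ∞) (by simp))

/-- Contraction with a vector, as a continuous linear map in the form. -/
def curryLeftCLM (n k : ℕ) (V : Type*) [NormedAddCommGroup V] [NormedSpace ℝ V] :
    (Euc n [⋀^Fin (k + 1)]→L[ℝ] V) →L[ℝ] Euc n →L[ℝ] Euc n [⋀^Fin k]→L[ℝ] V :=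
  LinearIsometry.toContinuousLinearMap ContinuousAlternatingMap.curryLeftLI

lemma curryLeftCLM_apply (a : Euc n [⋀^Fin (k + 1)]→L[ℝ] V) :
    curryLeftCLM n k V a = a.curryLeft := rfl

lemma contDiff_curryLeftCLM : ContDiff ℝ ∞ (curryLeftCLM n k V) := by
  fun_prop

lemma hasFDerivAt_curryLeftCLM (a : Euc n [⋀^Fin (k + 1)]→L[ℝ] V) :
    HasFDerivAt (curryLeftCLM n k V) (curryLeftCLM n k V) a :=
  (curryLeftCLM n k V).hasFDerivAt

lemma contDiff_cone_integrand {a : EForm n (k + 1) V} (ha : ContDiff ℝ ∞ a) :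
    ContDiff ℝ ∞ fun z : Euc n × ℝ => z.2 ^ k • (a (z.2 • z.1)).curryLeft z.1 := by
  refine ContDiff.smul (contDiff_snd.pow k) (ContDiff.clm_apply (𝕜 := ℝ)
    (f := fun z : Euc n × ℝ => (a (z.2 • z.1)).curryLeft) ?_ contDiff_fst)
  exact contDiff_curryLeftCLM.comp (ha.comp (contDiff_snd.smul contDiff_fst))

lemma contDiff_cone {a : EForm n (k + 1) V} (ha : ContDiff ℝ ∞ a) : ContDiff ℝ ∞ a.cone :=
  contDiff_intervalIntegral (contDiff_cone_integrand ha)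

lemma intervalIntegrable_cone {a : EForm n (k + 1) V} (ha : ContDiff ℝ ∞ a) (x : Euc n) :
    IntervalIntegrable (fun t : ℝ => t ^ k • (a (t • x)).curryLeft x) MeasureTheory.volume 0 1 :=
  ((contDiff_cone_integrand ha).continuous.comp
    (by fun_prop : Continuous fun t : ℝ => (x, t))).intervalIntegrable _ _

lemma cone_add {a b : EForm n (k + 1) V} (ha : ContDiff ℝ ∞ a) (hb : ContDiff ℝ ∞ b) :
    (a + b).cone = a.cone + b.cone := by
  funext x
  simp only [cone, Pi.add_apply]
  rw [← intervalIntegral.integral_add (intervalIntegrable_cone ha x) (intervalIntegrable_cone hb x)]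
  simp [smul_add]

lemma cone_apply [CompleteSpace V] {a : EForm n (k + 1) V} (ha : ContDiff ℝ ∞ a) (x : Euc n) (w : Fin k → Euc n) :
    a.cone x w = ∫ t in (0 : ℝ)..1, t ^ k • a (t • x) (Matrix.vecCons x w) :=
  ((ContinuousAlternatingMap.apply ℝ (Euc n) V w).intervalIntegral_comp_comm
    (intervalIntegrable_cone ha x)).symm

/-- A linear map commutes with the scaling `x ↦ t • x` and carries the radial vector at `x` to the
radial vector at `L x`. -/
lemma cone_pull_clm [CompleteSpace V] {m : ℕ} {a : EForm n (k + 1) V} (ha : ContDiff ℝ ∞ a)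
    (L : Euc m →L[ℝ] Euc n) :
    a.cone.pull L = (a.pull L).cone := by
  funext x
  simp only [pull, ContinuousLinearMap.fderiv]
  have := (ContinuousAlternatingMap.compContinuousLinearMapCLM (F := V) (ι := Fin k)
    L).intervalIntegral_comp_comm (intervalIntegrable_cone ha (L x))
  refine this.symm.trans (intervalIntegral.integral_congr fun t _ => ?_)
  simp only [pull, ContinuousLinearMap.fderiv, map_smul,
    ContinuousAlternatingMap.curryLeft_compContinuousLinearMap]
  rfl

lemma hasFDerivAt_cone_integrand {a : EForm n (k + 1) V} (ha : ContDiff ℝ ∞ a) (t : ℝ) (x : Euc n) :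
    HasFDerivAt (fun y => t ^ k • (a (t • y)).curryLeft y)
      (t ^ k • ((a (t • x)).curryLeft + t • ((ContinuousLinearMap.apply ℝ _ x).comp
        ((curryLeftCLM n k V).comp (fderiv ℝ a (t • x)))))) x := by
  have h1 : HasFDerivAt (fun y : Euc n => a (t • y))
      ((fderiv ℝ a (t • x)).comp (t • ContinuousLinearMap.id ℝ (Euc n))) x :=
    (ha.differentiable (by simp) (t • x)).hasFDerivAt.comp x
      ((hasFDerivAt_id x).const_smul t)
  have h2 := HasFDerivAt.comp (g := curryLeftCLM n k V) (F := Euc n [⋀^Fin (k + 1)]→L[ℝ] V)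
    (G := Euc n →L[ℝ] Euc n [⋀^Fin k]→L[ℝ] V) x (hasFDerivAt_curryLeftCLM (a (t • x))) h1
  have h3 := (h2.clm_apply (hasFDerivAt_id x)).const_smul (t ^ k)
  refine h3.congr_fderiv ?_
  ext u w
  simp [curryLeftCLM_apply]

/-- The point `x` enters the integrand twice, as the radial vector and through the base point `t •
x`; the second dependence produces the extra factor `t`. -/
lemma fderiv_cone_apply [CompleteSpace V] {a : EForm n (k + 1) V} (ha : ContDiff ℝ ∞ a) (x u : Euc n)
    (w : Fin k → Euc n) :
    fderiv ℝ a.cone x u w = ∫ t in (0 : ℝ)..1, t ^ k • (a (t • x) (Matrix.vecCons u w) +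
      t • fderiv ℝ a (t • x) u (Matrix.vecCons x w)) := by
  have hG := contDiff_cone_integrand ha
  have h1 : fderiv ℝ a.cone x = _ := (hasFDerivAt_intervalIntegral_of_contDiff hG x).fderiv
  rw [h1]
  have hc : Continuous fun t : ℝ => (fderiv ℝ (fun z : Euc n × ℝ =>
      z.2 ^ k • (a (z.2 • z.1)).curryLeft z.1) (x, t)).comp (ContinuousLinearMap.inl ℝ (Euc n) ℝ) :=
    ((hG.continuous_fderiv (by simp)).comp
      (by fun_prop : Continuous fun t : ℝ => (x, t))).clm_comp continuous_const
  have h2 := ContinuousLinearMap.intervalIntegral_comp_comm (E := Euc n →L[ℝ] Euc n [⋀^Fin k]→L[ℝ] V)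
    ((ContinuousAlternatingMap.apply ℝ (Euc n) V w).comp
      (ContinuousLinearMap.apply ℝ (Euc n [⋀^Fin k]→L[ℝ] V) u))
    (μ := MeasureTheory.volume)
    (Continuous.intervalIntegrable (E := Euc n →L[ℝ] Euc n [⋀^Fin k]→L[ℝ] V) hc 0 1)
  refine h2.symm.trans (intervalIntegral.integral_congr fun t _ => ?_)
  have h3 := HasFDerivAt.comp (f := fun y : Euc n => (y, t)) x
    (hG.differentiable (by simp) (x, t)).hasFDerivAt (hasFDerivAt_prodMk_left x t)
  have h4 := h3.unique (hasFDerivAt_cone_integrand ha t x)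
  simp only [h4]
  simp [curryLeftCLM_apply]

lemma extDeriv_eq_sum (a : EForm n k V) (x : Euc n) (v : Fin (k + 1) → Euc n) :
    extDeriv a x v = ∑ i : Fin (k + 1), (-1 : ℤ) ^ (i : ℕ) • fderiv ℝ a x (v i) (i.removeNth v) :=
  ContinuousAlternatingMap.alternatizeUncurryFin_apply _ _

/-- Splitting off the radial slot isolates the radial derivative; the remaining terms are those that
cancel against the derivative of the contraction in the Poincaré lemma. -/
lemma extDeriv_vecCons (a : EForm n (k + 1) V) (x y : Euc n) (v : Fin (k + 1) → Euc n) :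
    extDeriv a y (Matrix.vecCons x v) = fderiv ℝ a y x v -
      ∑ i : Fin (k + 1), (-1 : ℤ) ^ (i : ℕ) • fderiv ℝ a y (v i) (Matrix.vecCons x (i.removeNth v)) := by
  rw [extDeriv_eq_sum, Fin.sum_univ_succ, sub_eq_add_neg, ← Finset.sum_neg_distrib]
  congr 1
  · simp
  · refine Finset.sum_congr rfl fun i _ => ?_
    have : i.succ.removeNth (Matrix.vecCons x v) = Matrix.vecCons x (i.removeNth v) := by
      funext j
      refine Fin.cases ?_ (fun j => ?_) j <;> simp [Fin.removeNth]
    rw [this]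
    simp [pow_succ]

lemma hasDerivAt_comp_smul {a : EForm n k V} (ha : ContDiff ℝ ∞ a) (x : Euc n)
    (v : Fin k → Euc n) (t : ℝ) :
    HasDerivAt (fun t : ℝ => a (t • x) v) (fderiv ℝ a (t • x) x v) t := by
  have h1 := (ha.differentiable (by simp) (t • x)).hasFDerivAt.comp_hasDerivAt t
    ((hasDerivAt_id t).smul_const x)
  have h2 := (ContinuousAlternatingMap.apply ℝ (Euc n) V v).hasFDerivAt.comp_hasDerivAt t h1
  simpa [Function.comp_def] using h2

lemma continuous_fderiv_comp_smul {a : EForm n k V} (ha : ContDiff ℝ ∞ a) (x u : Euc n)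
    (v : Fin k → Euc n) : Continuous fun t : ℝ => fderiv ℝ a (t • x) u v :=
  (ContinuousAlternatingMap.apply ℝ (Euc n) V v).continuous.comp
    (((ha.continuous_fderiv (by simp)).comp (by fun_prop)).clm_apply continuous_const)

/-- The Poincaré lemma in positive degree: the radial contraction is a chain contraction. -/
lemma extDeriv_cone_add_cone_extDeriv [CompleteSpace V] {a : EForm n (k + 1) V} (ha : ContDiff ℝ ∞ a) :
    extDeriv a.cone + EForm.cone (extDeriv a) = a := by
  funext x
  ext v
  rw [Pi.add_apply, ContinuousAlternatingMap.add_apply, extDeriv_eq_sum,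
    cone_apply (contDiff_extDeriv ha)]
  simp only [fderiv_cone_apply ha]
  have hc1 : ∀ w, Continuous fun t : ℝ => a (t • x) w := fun w =>
    continuous_iff_continuousAt.2 fun t => (hasDerivAt_comp_smul ha x w t).continuousAt
  have hc2 := continuous_fderiv_comp_smul ha x
  have hc3 : Continuous fun t : ℝ => extDeriv a (t • x) (Matrix.vecCons x v) :=
    continuous_iff_continuousAt.2 fun t =>
      (hasDerivAt_comp_smul (contDiff_extDeriv ha) x _ t).continuousAt
  have hc4 : ∀ i : Fin (k + 1), Continuous fun t : ℝ => (-1 : ℤ) ^ (i : ℕ) • t ^ k •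
      (a (t • x) (Matrix.vecCons (v i) (i.removeNth v)) +
        t • fderiv ℝ a (t • x) (v i) (Matrix.vecCons x (i.removeNth v))) := fun i =>
    ((continuous_pow k).smul ((hc1 (Matrix.vecCons (v i) (i.removeNth v))).add
      (continuous_id.smul (hc2 (v i) (Matrix.vecCons x (i.removeNth v)))))).const_smul
      ((-1 : ℤ) ^ (i : ℕ))
  have h1 : ∀ i : Fin (k + 1), (-1 : ℤ) ^ (i : ℕ) • ∫ t in (0 : ℝ)..1, t ^ k •
      (a (t • x) (Matrix.vecCons (v i) (i.removeNth v)) +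
        t • fderiv ℝ a (t • x) (v i) (Matrix.vecCons x (i.removeNth v))) =
      ∫ t in (0 : ℝ)..1, ((-1 : ℤ) ^ (i : ℕ) • t ^ k •
      (a (t • x) (Matrix.vecCons (v i) (i.removeNth v)) +
        t • fderiv ℝ a (t • x) (v i) (Matrix.vecCons x (i.removeNth v)))) := fun i => by
    rw [← Int.cast_smul_eq_zsmul ℝ, ← intervalIntegral.integral_smul]
    simp only [Int.cast_smul_eq_zsmul]
  simp only [h1]
  rw [← intervalIntegral.integral_finsetSum, ← intervalIntegral.integral_add]
  -- The two integrands add up to the derivative of `t ^ (k + 1) • a (t • x) v`. The `k + 1` slots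
  -- each contribute `t ^ k • a (t • x) v`, the non-radial derivatives cancel, and the boundary term
  -- at `t = 0` vanishes because `k + 1 > 0`.
  · have hd : ∀ t : ℝ, HasDerivAt (fun t : ℝ => t ^ (k + 1) • a (t • x) v)
        (t ^ (k + 1) • fderiv ℝ a (t • x) x v + (((k + 1 : ℕ) : ℝ) * t ^ k) • a (t • x) v) t :=
      fun t => (hasDerivAt_pow (k + 1) t).smul (hasDerivAt_comp_smul ha x v t)
    have hint := intervalIntegral.integral_eq_sub_of_hasDerivAt (a := 0) (b := 1)
      (fun t _ => hd t) ((((continuous_pow (k + 1)).smul (hc2 x v)).add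
        ((continuous_const.mul (continuous_pow k)).smul (hc1 v))).intervalIntegrable _ _)
    simp only [one_smul, one_pow, zero_smul, ne_eq, Nat.add_eq_zero_iff, one_ne_zero, and_false,
      not_false_eq_true, zero_pow, sub_zero] at hint
    rw [← hint]
    refine intervalIntegral.integral_congr fun t _ => ?_
    have h2 : ∀ i : Fin (k + 1), (-1 : ℤ) ^ (i : ℕ) •
        a (t • x) (Matrix.vecCons (v i) (i.removeNth v)) = a (t • x) v := fun i => by
      rw [← ContinuousAlternatingMap.neg_one_pow_smul_map_insertNth, smul_smul, ← pow_add,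
        Even.neg_one_pow ⟨_, rfl⟩, one_smul, Fin.insertNth_self_removeNth]
    have h3 : ∀ i : Fin (k + 1), (-1 : ℤ) ^ (i : ℕ) • t ^ k •
      (a (t • x) (Matrix.vecCons (v i) (i.removeNth v)) +
        t • fderiv ℝ a (t • x) (v i) (Matrix.vecCons x (i.removeNth v))) =
        t ^ k • a (t • x) v + t ^ (k + 1) •
        (-1 : ℤ) ^ (i : ℕ) • fderiv ℝ a (t • x) (v i) (Matrix.vecCons x (i.removeNth v)) := by
      intro i
      rw [smul_comm _ (t ^ k), smul_add, h2, smul_add, smul_comm _ t, smul_smul, ← pow_succ]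
    simp only [h3, Finset.sum_add_distrib, ← Finset.smul_sum, extDeriv_vecCons, smul_sub,
      Finset.sum_const, Finset.card_univ, Fintype.card_fin]
    rw [mul_smul, Nat.cast_smul_eq_nsmul, smul_comm (t ^ k)]
    abel
  · exact (continuous_finsetSum _ fun i _ => hc4 i).intervalIntegrable _ _
  · exact ((continuous_pow (k + 1)).smul hc3).intervalIntegrable _ _
  · exact fun i _ => (hc4 i).intervalIntegrable _ _

/-- The Poincaré lemma in degree zero. -/
lemma cone_extDeriv_zero [CompleteSpace V] {a : EForm n 0 V} (ha : ContDiff ℝ ∞ a) :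
    EForm.cone (extDeriv a) = fun x => a x - a 0 := by
  funext x
  ext v
  rw [cone_apply (contDiff_extDeriv ha), ContinuousAlternatingMap.sub_apply]
  have hint := intervalIntegral.integral_eq_sub_of_hasDerivAt (a := 0) (b := 1)
      (fun t _ => hasDerivAt_comp_smul ha x v t)
      ((continuous_fderiv_comp_smul ha x x v).intervalIntegrable _ _)
  rw [one_smul, zero_smul] at hint
  rw [← hint]
  refine intervalIntegral.integral_congr fun t _ => ?_
  beta_reduce
  rw [extDeriv_eq_sum, Fin.sum_univ_one, Fin.val_zero, pow_zero, pow_zero, one_smul, one_smul]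
  exact congrArg _ (Subsingleton.elim _ _)

end EForm

/-! ### Affine maps of simplices and their action on forms. -/

section SimpMap

/-- The linear part of `simpMap θ`. -/
def simpLin {m n : ℕ} (θ : Fin (m + 1) → Fin (n + 1)) : Euc m →L[ℝ] Euc n :=
  ∑ i : Fin m, (EuclideanSpace.proj i : Euc m →L[ℝ] ℝ).smulRight (vert (θ i.succ) - vert (θ 0))

lemma simpMap_eq {m n : ℕ} (θ : Fin (m + 1) → Fin (n + 1)) (x : Euc m) :
    simpMap θ x = vert (θ 0) + simpLin θ x := by
  simp only [simpMap, simpLin, Fin.sum_univ_succ, bary, Fin.cons_zero, Fin.cons_succ,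
    _root_.sum_apply, ContinuousLinearMap.smulRight_apply, PiLp.proj_apply, smul_sub,
    Finset.sum_sub_distrib, ← Finset.sum_smul, sub_smul, one_smul]
  abel

lemma hasFDerivAt_simpMap {m n : ℕ} (θ : Fin (m + 1) → Fin (n + 1)) (x : Euc m) :
    HasFDerivAt (simpMap θ) (simpLin θ) x := by
  have : simpMap θ = fun x => vert (θ 0) + simpLin θ x := funext (simpMap_eq θ)
  rw [this]
  exact (simpLin θ).hasFDerivAt.const_add _

lemma simpMap_eq_simpLin {m n : ℕ} {θ : Fin (m + 1) → Fin (n + 1)} (h : θ 0 = 0) :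
    simpMap θ = simpLin θ := by
  funext x
  simp [simpMap_eq, h, vert]

lemma simpMap_simpMap {l m n : ℕ} (θ : Fin (m + 1) → Fin (n + 1)) (φ : Fin (l + 1) → Fin (m + 1))
    (x : Euc l) : simpMap θ (simpMap φ x) = simpMap (θ ∘ φ) x := by
  have hb : ∑ j, bary x j = 1 := by simp [Fin.sum_univ_succ, bary]
  have hv : ∀ j, vert (θ (φ j)) = vert (θ 0) + simpLin θ (vert (φ j)) := fun j => by
    rw [← simpMap_eq, simpMap_vert]
  rw [simpMap_eq]
  simp only [simpMap, map_sum, map_smul, Function.comp_apply]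
  simp only [hv, smul_add, Finset.sum_add_distrib, ← Finset.sum_smul, hb, one_smul]

namespace EForm

variable {V : Type*} [NormedAddCommGroup V] [NormedSpace ℝ V] {k : ℕ}

lemma pull_simpMap {m n : ℕ} (θ : Fin (m + 1) → Fin (n + 1)) (a : EForm n k V) (x : Euc m) :
    a.pull (simpMap θ) x = (a (simpMap θ x)).compContinuousLinearMap (simpLin θ) := by
  rw [pull, (hasFDerivAt_simpMap θ x).fderiv]

lemma contDiff_pull_simpMap {m n : ℕ} (θ : Fin (m + 1) → Fin (n + 1)) {a : EForm n k V}
    (ha : ContDiff ℝ ∞ a) : ContDiff ℝ ∞ (a.pull (simpMap θ)) := by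
  have : a.pull (simpMap θ) = fun x =>
      ContinuousAlternatingMap.compContinuousLinearMapCLM (simpLin θ) (a (simpMap θ x)) :=
    funext fun x => pull_simpMap θ a x
  rw [this]
  exact (ContinuousLinearMap.contDiff _).comp (ha.comp (contDiff_simpMap θ))

lemma pull_simpMap_simpMap {l m n : ℕ} (θ : Fin (m + 1) → Fin (n + 1))
    (φ : Fin (l + 1) → Fin (m + 1)) (a : EForm n k V) :
    (a.pull (simpMap θ)).pull (simpMap φ) = a.pull (simpMap (θ ∘ φ)) := by
  have : simpLin (θ ∘ φ) = (simpLin θ).comp (simpLin φ) := by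
    have h := (hasFDerivAt_simpMap θ _).comp 0 (hasFDerivAt_simpMap φ 0)
    have h' : simpMap θ ∘ simpMap φ = simpMap (θ ∘ φ) := funext (simpMap_simpMap θ φ)
    rw [h'] at h
    exact (hasFDerivAt_simpMap (θ ∘ φ) 0).unique h
  funext x
  simp only [pull_simpMap, this, simpMap_simpMap]
  rfl

lemma extDeriv_pull_simpMap {m n : ℕ} (θ : Fin (m + 1) → Fin (n + 1)) {a : EForm n k V}
    (ha : ContDiff ℝ ∞ a) :
    extDeriv (a.pull (simpMap θ)) = EForm.pull (simpMap θ) (extDeriv a) := by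
  funext x
  exact extDeriv_pullback (r := ∞) (ha.differentiable (by simp) _)
    (contDiff_simpMap θ).contDiffAt
    (by simpa using (WithTop.coe_le_coe.2 le_top : ((2 : ℕ∞) : WithTop ℕ∞) ≤ ∞))

/-- Contraction commutes with restriction to faces that contain the apex `0`, since the affine
inclusion is then linear. -/
lemma cone_pull_simpMap [CompleteSpace V] {m n : ℕ} {θ : Fin (m + 1) → Fin (n + 1)} (h : θ 0 = 0)
    {a : EForm n (k + 1) V} (ha : ContDiff ℝ ∞ a) :
    a.cone.pull (simpMap θ) = (a.pull (simpMap θ)).cone := by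
  rw [simpMap_eq_simpLin h, cone_pull_clm ha]

end EForm

end SimpMap

/-! ### Column operations on the arguments of an alternating form. -/

section AlternatingFrames

variable {E V : Type*} [NormedAddCommGroup E] [NormedSpace ℝ E] [NormedAddCommGroup V]
  [NormedSpace ℝ V] {n : ℕ}

lemma alternating_vecCons_add_sum (A : E [⋀^Fin (n + 1)]→L[ℝ] V) (x : E) (c : Fin n → ℝ)
    (w : Fin n → E) :
    A (Matrix.vecCons (x + ∑ i, c i • w i) w) = A (Matrix.vecCons x w) := by
  have h0 : ∀ i, A.curryLeft (w i) w = 0 := fun i =>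
    A.map_eq_zero_of_eq _ (i := 0) (j := i.succ) (by simp) (Fin.succ_ne_zero i).symm
  rw [← ContinuousAlternatingMap.curryLeft_apply_apply, map_add, map_sum]
  simp [h0]

lemma alternating_vecCons_sub (A : E [⋀^Fin (n + 1)]→L[ℝ] V) (x : E) (w : Fin n → E) :
    A (Matrix.vecCons x fun i => w i - x) = A (Matrix.vecCons x w) := by
  -- The slots are treated one at a time; each correction term has `x` in two slots and vanishes.
  have key : ∀ s : Finset (Fin n), A.curryLeft x (s.piecewise (fun i => w i - x) w) =
      A.curryLeft x w := by
    intro s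
    induction s using Finset.induction_on with
    | empty => simp
    | insert i s hi ih =>
      rw [Finset.piecewise_insert, ContinuousAlternatingMap.map_update_sub]
      have h1 : Function.update (s.piecewise (fun i => w i - x) w) i (w i) =
          s.piecewise (fun i => w i - x) w := by
        rw [Function.update_eq_self_iff, Finset.piecewise_eq_of_notMem _ _ _ hi]
      have h2 : A.curryLeft x (Function.update (s.piecewise (fun i => w i - x) w) i x) = 0 :=
        A.map_eq_zero_of_eq _ (i := 0) (j := i.succ) (by simp) (Fin.succ_ne_zero i).symm
      rw [h1, h2, ih, sub_zero]
  simpa using key Finset.univ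

end AlternatingFrames

/-! ### Polar coordinates on the simplex about the vertex `0`. -/

section ConeCoordinates

open MeasureTheory
open scoped Pointwise

lemma isClosed_stdSimp (n : ℕ) : IsClosed (stdSimp n) := (isCompact_stdSimp n).isClosed

/-- Coordinates on `Euc (n + 1)`: the last `n` coordinates and the sum of all coordinates. -/
def sumCoord (n : ℕ) (p : Euc n × ℝ) : Euc (n + 1) :=
  WithLp.toLp 2 (Fin.cons (p.2 - ∑ i, p.1 i) fun i => p.1 i)

@[simp] lemma sumCoord_zero {n : ℕ} (p : Euc n × ℝ) : sumCoord n p 0 = p.2 - ∑ i, p.1 i := rfl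

@[simp] lemma sumCoord_succ {n : ℕ} (p : Euc n × ℝ) (i : Fin n) : sumCoord n p i.succ = p.1 i := rfl

lemma continuous_sumCoord (n : ℕ) : Continuous (sumCoord n) := by
  refine (PiLp.continuous_toLp 2 _).comp (continuous_pi fun i => ?_)
  refine Fin.cases ?_ (fun i => ?_) i
  · simp only [Fin.cons_zero]; fun_prop
  · simp only [Fin.cons_succ]; fun_prop

lemma injective_sumCoord (n : ℕ) : Function.Injective (sumCoord n) := by
  intro p q h
  have h1 : p.1 = q.1 := by
    ext i
    rw [← sumCoord_succ p i, h, sumCoord_succ]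
  have h0 : p.2 - ∑ i, p.1 i = q.2 - ∑ i, q.1 i := by
    rw [← sumCoord_zero p, h, sumCoord_zero]
  rw [h1] at h0
  exact Prod.ext h1 (by linarith)

/-- The coordinate change is a shear followed by a reordering of coordinates, hence unimodular. -/
lemma measurePreserving_sumCoord (n : ℕ) : MeasurePreserving (sumCoord n) := by
  have h1 : MeasurePreserving (fun p : Euc n × ℝ => (p.1, p.2 - ∑ i, p.1 i)) :=
    (MeasurePreserving.id (volume : Measure (Euc n))).skew_product
      (g := fun (w : Euc n) (t : ℝ) => t - ∑ i, w i)
      (by simp only [Function.uncurry_def]; fun_prop)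
      (Filter.Eventually.of_forall fun w => (measurePreserving_sub_right volume _).map_eq)
  have h2 : MeasurePreserving (fun p : Euc n × ℝ => (WithLp.ofLp p.1, p.2)) :=
    (EuclideanSpace.volume_preserving_symm_measurableEquiv_toLp (Fin n)).prod
      (MeasurePreserving.id (volume : Measure ℝ))
  have h3 : MeasurePreserving (Prod.swap : (Fin n → ℝ) × ℝ → ℝ × (Fin n → ℝ)) :=
    Measure.measurePreserving_swap
  have h4 := (volume_preserving_piFinSuccAbove (fun _ : Fin (n + 1) => ℝ) 0).symm
  have h5 := (EuclideanSpace.volume_preserving_symm_measurableEquiv_toLp (Fin (n + 1))).symm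
  convert h5.comp (h4.comp (h3.comp (h2.comp h1))) using 1
  funext p
  ext i
  refine Fin.cases ?_ (fun i => ?_) i
  · rfl
  · rfl

lemma preimage_stdSimp_sumCoord {n : ℕ} (p : Euc n × ℝ) :
    sumCoord n p ∈ stdSimp (n + 1) ↔ (∀ i, 0 ≤ p.1 i) ∧ ∑ i, p.1 i ≤ p.2 ∧ p.2 ≤ 1 := by
  simp only [stdSimp, Set.mem_ofPred_eq, Fin.forall_fin_succ, Fin.sum_univ_succ, sumCoord_zero,
    sumCoord_succ, sub_add_cancel, sub_nonneg]
  tauto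

lemma smul_stdSimp {n : ℕ} {t : ℝ} (ht : 0 < t) :
    t • stdSimp n = {w | (∀ i, 0 ≤ w i) ∧ ∑ i, w i ≤ t} := by
  ext w
  rw [Set.mem_smul_set_iff_inv_smul_mem₀ ht.ne']
  simp only [stdSimp, Set.mem_ofPred_eq, PiLp.smul_apply, smul_eq_mul, ← Finset.mul_sum]
  have : ∀ r : ℝ, 0 ≤ t⁻¹ * r ↔ 0 ≤ r := fun r => by
    rw [mul_nonneg_iff_of_pos_left (inv_pos.2 ht)]
  simp only [this, inv_mul_le_iff₀ ht, mul_one]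

lemma sumCoord_smul {n : ℕ} (t : ℝ) (y : Euc n) :
    sumCoord n (t • y, t) = t • simpMap (Fin.succAbove 0) y := by
  have h : simpMap (Fin.succAbove 0) y = sumCoord n (y, 1) := by
    ext i
    simp only [simpMap, Fin.sum_univ_succ, bary, Fin.cons_zero, Fin.cons_succ, vert,
      Fin.zero_succAbove]
    refine Fin.cases ?_ (fun i => ?_) i
    · simp
    · simp [Pi.single_apply]
  rw [h]
  ext i
  refine Fin.cases ?_ (fun i => ?_) i
  · simp [← Finset.mul_sum, mul_sub]
  · simp

variable {V : Type*} [NormedAddCommGroup V] [NormedSpace ℝ V]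

/-- Integration over the simplex in polar coordinates about the vertex `0`. -/
lemma integral_stdSimp_succ {n : ℕ} {f : Euc (n + 1) → V} (hf : Continuous f) :
    ∫ x in stdSimp (n + 1), f x =
      ∫ y in stdSimp n, ∫ t in (0 : ℝ)..1, t ^ n • f (t • simpMap (Fin.succAbove 0) y) := by
  set R := sumCoord n ⁻¹' stdSimp (n + 1) with hR
  have hRm : ∀ p, p ∈ R ↔ (∀ i, 0 ≤ p.1 i) ∧ ∑ i, p.1 i ≤ p.2 ∧ p.2 ≤ 1 :=
    preimage_stdSimp_sumCoord
  have hRc : IsClosed R := (isClosed_stdSimp (n + 1)).preimage (continuous_sumCoord n)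
  have hRk : IsCompact R := by
    refine ((isCompact_stdSimp n).prod (isCompact_Icc (a := (0 : ℝ)) (b := 1))).of_isClosed_subset
      hRc fun p hp => ?_
    obtain ⟨h0, h1, h2⟩ := (hRm p).1 hp
    exact ⟨⟨h0, h1.trans h2⟩, (Finset.sum_nonneg fun i _ => h0 i).trans h1, h2⟩
  have hemb : MeasurableEmbedding (sumCoord n) :=
    (continuous_sumCoord n).measurableEmbedding (injective_sumCoord n)
  rw [← (measurePreserving_sumCoord n).setIntegral_preimage_emb hemb, ← hR,
    ← integral_indicator hRc.measurableSet]
  have hint : Integrable (R.indicator fun p => f (sumCoord n p)) (volume.prod volume) := by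
    rw [integrable_indicator_iff hRc.measurableSet]
    exact (hf.comp (continuous_sumCoord n)).continuousOn.integrableOn_compact hRk
  have hprod := integral_prod_symm _ hint
  rw [← Measure.volume_eq_prod] at hprod
  rw [hprod]
  have hzero : ∀ t ∉ Set.Icc (0 : ℝ) 1,
      ∫ w, R.indicator (fun p => f (sumCoord n p)) (w, t) = 0 := by
    intro t ht
    refine integral_eq_zero_of_ae (Filter.Eventually.of_forall fun w => ?_)
    refine Set.indicator_of_notMem (fun hw => ht ?_) _
    obtain ⟨h0, h1, h2⟩ := (hRm _).1 hw
    exact ⟨(Finset.sum_nonneg fun i _ => h0 i).trans h1, h2⟩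
  -- The half-open interval discards `t = 0`, where the rescaling of the slice is not invertible.
  rw [← setIntegral_eq_integral_of_forall_compl_eq_zero hzero, integral_Icc_eq_integral_Ioc]
  have hslice : ∀ t ∈ Set.Ioc (0 : ℝ) 1,
      ∫ w, R.indicator (fun p => f (sumCoord n p)) (w, t) =
        ∫ y in stdSimp n, t ^ n • f (t • simpMap (Fin.succAbove 0) y) := by
    intro t ht
    have h1 : (fun w => R.indicator (fun p => f (sumCoord n p)) (w, t)) =
        (t • stdSimp n).indicator fun w => f (sumCoord n (w, t)) := by
      funext w
      have hmem : (w, t) ∈ R ↔ w ∈ t • stdSimp n := by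
        rw [hRm, smul_stdSimp ht.1]
        simp [ht.2]
      by_cases h : w ∈ t • stdSimp n
      · rw [Set.indicator_of_mem h, Set.indicator_of_mem (hmem.2 h)]
      · rw [Set.indicator_of_notMem h, Set.indicator_of_notMem (mt hmem.1 h)]
    have hm : MeasurableSet (t • stdSimp n) :=
      ((isCompact_stdSimp n).smul t).isClosed.measurableSet
    -- The slice where the coordinates sum to `t` is the simplex scaled by `t`; substituting `w = t
    -- • y` produces the Jacobian `t ^ n`.
    have h2 := Measure.setIntegral_comp_smul_of_pos volume (fun w => f (sumCoord n (w, t)))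
      (stdSimp n) ht.1
    have h3 : t ^ n ≠ 0 := pow_ne_zero _ ht.1.ne'
    rw [h1, integral_indicator hm, integral_smul]
    simp only [sumCoord_smul, finrank_euclideanSpace_fin] at h2
    rw [h2, smul_smul, mul_inv_cancel₀ h3, one_smul]
  rw [setIntegral_congr_fun measurableSet_Ioc hslice]
  have hcont : Continuous fun p : ℝ × Euc n => p.1 ^ n • f (p.1 • simpMap (Fin.succAbove 0) p.2) :=
    (continuous_fst.pow n).smul (hf.comp (continuous_fst.smul
      ((contDiff_simpMap (Fin.succAbove 0)).continuous.comp continuous_snd)))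
  have hint2 : Integrable (Function.uncurry fun (t : ℝ) (y : Euc n) =>
      t ^ n • f (t • simpMap (Fin.succAbove 0) y))
      ((volume.restrict (Set.Ioc 0 1)).prod (volume.restrict (stdSimp n))) := by
    rw [Measure.prod_restrict]
    exact (hcont.continuousOn.integrableOn_compact
      ((isCompact_Icc (a := (0 : ℝ)) (b := 1)).prod (isCompact_stdSimp n))).mono_set
      (Set.prod_mono_left Set.Ioc_subset_Icc_self)
  rw [integral_integral_swap hint2]
  simp only [intervalIntegral.integral_of_le zero_le_one]

end ConeCoordinates

/-! ### Stokes' theorem on the standard simplex. -/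

section Stokes

variable {V : Type*} [NormedAddCommGroup V] [NormedSpace ℝ V]

namespace EForm

lemma continuous_apply {n k : ℕ} {a : EForm n k V} (ha : Continuous a) (v : Fin k → Euc n) :
    Continuous fun x => a x v :=
  (ContinuousAlternatingMap.apply ℝ (Euc n) V v).continuous.comp ha

lemma integrableOn_simpInt {n : ℕ} {a : EForm n n V} (ha : Continuous a) :
    MeasureTheory.IntegrableOn (fun x => a x fun i => EuclideanSpace.single i (1 : ℝ))
      (stdSimp n) :=
  (continuous_apply ha _).continuousOn.integrableOn_compact (isCompact_stdSimp n)

lemma simpInt_add {n : ℕ} {a b : EForm n n V} (ha : Continuous a) (hb : Continuous b) :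
    (a + b).simpInt = a.simpInt + b.simpInt :=
  MeasureTheory.integral_add (integrableOn_simpInt ha) (integrableOn_simpInt hb)

lemma simpInt_sub {n : ℕ} {a b : EForm n n V} (ha : Continuous a) (hb : Continuous b) :
    (a - b).simpInt = a.simpInt - b.simpInt :=
  MeasureTheory.integral_sub (integrableOn_simpInt ha) (integrableOn_simpInt hb)

lemma simpInt_smul {n : ℕ} (c : ℝ) (a : EForm n n V) : (c • a).simpInt = c • a.simpInt :=
  MeasureTheory.integral_smul c _

lemma simpInt_congr {n : ℕ} {a b : EForm n n V} (h : Set.EqOn a b (stdSimp n)) :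
    a.simpInt = b.simpInt :=
  MeasureTheory.setIntegral_congr_fun (isClosed_stdSimp n).measurableSet
    fun x hx => by simp only [h hx]

lemma simpInt_zero [CompleteSpace V] (a : EForm 0 0 V) : a.simpInt = a 0 0 := by
  have h1 : stdSimp 0 = Set.univ := by
    ext x; simp [stdSimp]
  have h2 : ∀ x : Euc 0, (a x fun i => EuclideanSpace.single i (1 : ℝ)) = a 0 0 := fun x => by
    rw [Subsingleton.elim x 0]; exact congrArg _ (Subsingleton.elim _ _)
  have h3 : (MeasureTheory.volume : MeasureTheory.Measure (Euc 0)).real Set.univ = 1 := by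
    rw [MeasureTheory.Measure.real,
      ← (EuclideanSpace.volume_preserving_symm_measurableEquiv_toLp (Fin 0)).symm.map_eq,
      MeasurableEquiv.map_apply]
    simp [MeasureTheory.volume_pi]
  rw [simpInt, h1]
  simp only [h2, MeasureTheory.setIntegral_const, h3, one_smul]

variable [CompleteSpace V]

/-- In polar coordinates the inner integral over `t` is the radial contraction, evaluated on the
frame of the face opposite to `0`. -/
lemma simpInt_succ {n : ℕ} {a : EForm (n + 1) (n + 1) V} (ha : ContDiff ℝ ∞ a) :
    a.simpInt = (a.cone.pull (simpMap (Fin.succAbove 0))).simpInt := by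
  rw [simpInt, integral_stdSimp_succ (continuous_apply ha.continuous _), simpInt]
  congr 1
  funext y
  rw [pull_simpMap, ContinuousAlternatingMap.compContinuousLinearMap_apply, cone_apply ha]
  refine intervalIntegral.integral_congr fun t _ => ?_
  beta_reduce
  congr 1
  have hL : ∀ i : Fin n, simpLin (Fin.succAbove 0) (EuclideanSpace.single i (1 : ℝ)) =
      (EuclideanSpace.single i.succ 1 - EuclideanSpace.single 0 1 : Euc (n + 1)) := by
    intro i
    have h := simpMap_eq (Fin.succAbove 0) (vert i.succ : Euc n)
    rw [simpMap_vert] at h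
    have h' := eq_sub_of_add_eq' h.symm
    simpa [vert, Fin.zero_succAbove] using h'
  have hy : simpMap (Fin.succAbove 0) y = EuclideanSpace.single 0 1 +
      ∑ i, y i • (EuclideanSpace.single i.succ 1 - EuclideanSpace.single 0 1 : Euc (n + 1)) := by
    rw [simpMap_eq]
    simp [simpLin, vert, Fin.zero_succAbove]
  have hw : (⇑(simpLin (Fin.succAbove 0)) ∘ fun i : Fin n => EuclideanSpace.single i (1 : ℝ)) =
      fun i => (EuclideanSpace.single i.succ 1 - EuclideanSpace.single 0 1 : Euc (n + 1)) :=
    funext hL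
  -- A point of the opposite face is `e₀` plus a combination of the edge vectors `eᵢ₊₁ - e₀`. Column
  -- operations therefore turn the frame of this point and the edges into the standard basis.
  rw [hw, hy, alternating_vecCons_add_sum, alternating_vecCons_sub]
  congr 1
  funext i
  refine Fin.cases ?_ (fun i => ?_) i <;> simp

/-- Stokes' theorem on the standard simplex. -/
lemma simpInt_extDeriv {n : ℕ} {a : EForm (n + 1) n V} (ha : ContDiff ℝ ∞ a) :
    EForm.simpInt (extDeriv a) =
      ∑ i : Fin (n + 2), (-1 : ℤ) ^ (i : ℕ) • (a.pull (simpMap i.succAbove)).simpInt := by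
  induction n with
  | zero =>
    -- In dimension one this is the fundamental theorem of calculus: face `0` is the far endpoint
    -- and face `1` is the vertex `0`.
    rw [simpInt_succ (contDiff_extDeriv ha), cone_extDeriv_zero ha, Fin.sum_univ_two]
    simp only [simpInt_zero, pull_simpMap]
    have h0 : ∀ i : Fin 2, simpMap i.succAbove (0 : Euc 0) = vert (i.succAbove 0) := fun i => by
      rw [← simpMap_vert]; congr 1
    simp only [h0, ContinuousAlternatingMap.compContinuousLinearMap_apply,
      ContinuousAlternatingMap.sub_apply]
    simp only [Fin.val_zero, Fin.val_one, pow_zero, pow_one, one_smul, neg_smul, ← sub_eq_add_neg]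
    congr 1
  | succ n ih =>
    have hda := contDiff_extDeriv ha
    have hs := contDiff_cone ha
    have h0 : EForm.cone (extDeriv a) = a - extDeriv a.cone :=
      eq_sub_of_add_eq' (extDeriv_cone_add_cone_extDeriv ha)
    have h1 : EForm.pull (simpMap (Fin.succAbove 0)) (a - extDeriv a.cone) =
        a.pull (simpMap (Fin.succAbove 0)) -
          extDeriv (a.cone.pull (simpMap (Fin.succAbove 0))) := by
      rw [extDeriv_pull_simpMap _ hs]; rfl
    rw [simpInt_succ hda, h0, h1, simpInt_sub (contDiff_pull_simpMap _ ha).continuous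
      (contDiff_extDeriv (contDiff_pull_simpMap _ hs)).continuous,
      ih (contDiff_pull_simpMap _ hs), Fin.sum_univ_succ (n := n + 2), sub_eq_add_neg,
      ← Finset.sum_neg_distrib]
    congr 1
    · simp
    · refine Finset.sum_congr rfl fun j _ => ?_
      -- Face `j` of face `0` is face `0` of face `j + 1`. The latter contains the apex, so
      -- contraction commutes with restricting to it, and the polar coordinate formula on that face
      -- recovers the integral of `a`.
      have hcomp : (Fin.succAbove (0 : Fin (n + 3))) ∘ j.succAbove =
          j.succ.succAbove ∘ Fin.succAbove 0 := by
        funext k; simp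
      rw [simpInt_succ (contDiff_pull_simpMap _ ha), ← cone_pull_simpMap (by simp) ha,
        pull_simpMap_simpMap, pull_simpMap_simpMap, hcomp]
      simp [pow_succ]

end EForm

end Stokes

/-! ### Simplicial identities: faces of faces, and faces of a cup product. -/

section Combinatorics

lemma sum_sum_succAbove_succAbove {C : Type*} [AddCommGroup C] {m : ℕ}
    (H : (Fin (m + 1) → Fin (m + 3)) → C) :
    ∑ i : Fin (m + 3), (-1 : ℤ) ^ (i : ℕ) • ∑ j : Fin (m + 2), (-1 : ℤ) ^ (j : ℕ) •
      H (i.succAbove ∘ j.succAbove) = 0 := by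
  simp only [Finset.smul_sum, ← Finset.sum_product', Finset.univ_product_univ, smul_smul, ← pow_add]
  -- Removing two vertices in either order gives the same map with opposite signs; the involution
  -- exchanges the two orders.
  refine Finset.sum_involution (fun x _ => (x.1.succAbove x.2, x.2.predAbove x.1)) ?_ ?_ ?_ ?_
  · rintro ⟨i, j⟩ -
    have h : (i.succAbove j).succAbove ∘ (j.predAbove i).succAbove = i.succAbove ∘ j.succAbove := by
      funext k
      exact Fin.succAbove_succAbove_succAbove_predAbove i j k
    simp only [h, Fin.neg_one_pow_succAbove_add_predAbove, neg_smul, add_neg_cancel]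
  · rintro ⟨i, j⟩ - - h
    exact Fin.succAbove_ne i j (congrArg Prod.fst h)
  · simp
  · rintro ⟨i, j⟩ -
    exact Prod.ext (Fin.succAbove_succAbove_predAbove i j) (Fin.predAbove_predAbove_succAbove i j)

variable {A B C : Type*} [AddCommGroup A] [AddCommGroup B] [AddCommGroup C]

/-- The combinatorics of the Leibniz rule for the cup product. -/
lemma sum_faces_cup (μ : A → B → C) (hl : ∀ a a' b, μ (a + a') b = μ a b + μ a' b)
    (hr : ∀ a b b', μ a (b + b') = μ a b + μ a b') {p q n : ℕ} (h : p + q = n)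
    (F : (Fin (p + 1) → Fin (n + 2)) → A) (G : (Fin (q + 1) → Fin (n + 2)) → B) :
    μ (∑ i : Fin (p + 2), (-1 : ℤ) ^ (i : ℕ) •
        F (frontIncl (p := p + 1) (q := q) (by omega) ∘ i.succAbove))
        (G (backIncl (p := p + 1) (q := q) (by omega))) +
      (-1 : ℤ) ^ p • μ (F (frontIncl (p := p) (q := q + 1) (by omega)))
        (∑ j : Fin (q + 2), (-1 : ℤ) ^ (j : ℕ) •
          G (backIncl (p := p) (q := q + 1) (by omega) ∘ j.succAbove)) =
      ∑ i : Fin (n + 2), (-1 : ℤ) ^ (i : ℕ) •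
        μ (F (i.succAbove ∘ frontIncl h)) (G (i.succAbove ∘ backIncl h)) := by
  subst h
  let ν : A →+ B →+ C := AddMonoidHom.mk' (fun a => AddMonoidHom.mk' (μ a) (hr a))
    fun a a' => by ext b; exact hl a a' b
  change ν _ _ + _ • ν _ _ = ∑ i : Fin (p + q + 2), (-1 : ℤ) ^ (i : ℕ) • ν _ _
  have hN : p + 1 + (q + 1) = p + q + 2 := by omega
  -- The `p + q + 2` faces split according to whether the omitted vertex is one of the first `p + 1`
  -- or one of the last `q + 1`. On the other side the last face of the front part and face `0` of
  -- the back part are set apart.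
  rw [← (finCongr hN).sum_comp, Fin.sum_univ_add (a := p + 1) (b := q + 1),
    Fin.sum_univ_castSucc (n := p + 1),
    Fin.sum_univ_succ (n := q + 1)]
  simp only [map_add, map_sum, map_zsmul, AddMonoidHom.add_apply, AddMonoidHom.finsetSum_apply,
    AddMonoidHom.zsmul_apply, smul_add, Finset.smul_sum, smul_smul, ← pow_add]
  have e1 : ∀ i : Fin (p + 1),
      ((frontIncl (p := p + 1) (q := q) (n := p + q + 1) (by omega)) ∘ i.castSucc.succAbove :
        Fin (p + 1) → Fin (p + q + 2)) =
        (finCongr hN (Fin.castAdd (q + 1) i)).succAbove ∘ frontIncl rfl := by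
    intro i; funext k; ext
    simp only [Function.comp_apply, frontIncl, Fin.succAbove, Fin.lt_def, finCongr_apply,
      Fin.val_cast, Fin.val_castAdd, Fin.val_castSucc]
    split_ifs <;> simp
  have e2 : ∀ i : Fin (p + 1),
      (backIncl (p := p + 1) (q := q) (n := p + q + 1) (by omega) :
        Fin (q + 1) → Fin (p + q + 2)) =
        (finCongr hN (Fin.castAdd (q + 1) i)).succAbove ∘ backIncl rfl := by
    intro i; funext k; ext
    have := i.2
    simp only [Function.comp_apply, backIncl, Fin.succAbove, Fin.lt_def, finCongr_apply,
      Fin.val_cast, Fin.val_castAdd, Fin.val_castSucc]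
    split_ifs
    · omega
    · simp; omega
  have e3 : ∀ j : Fin (q + 1),
      (frontIncl (p := p) (q := q + 1) (n := p + q + 1) (by omega) :
        Fin (p + 1) → Fin (p + q + 2)) =
        (finCongr hN (Fin.natAdd (p + 1) j)).succAbove ∘ frontIncl rfl := by
    intro j; funext k; ext
    have := k.2
    simp only [Function.comp_apply, frontIncl, Fin.succAbove, Fin.lt_def, finCongr_apply,
      Fin.val_cast, Fin.val_natAdd, Fin.val_castSucc]
    split_ifs
    · simp
    · omega
  have e4 : ∀ j : Fin (q + 1),
      ((backIncl (p := p) (q := q + 1) (n := p + q + 1) (by omega)) ∘ j.succ.succAbove :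
        Fin (q + 1) → Fin (p + q + 2)) =
        (finCongr hN (Fin.natAdd (p + 1) j)).succAbove ∘ backIncl rfl := by
    intro j; funext k; ext
    simp only [Function.comp_apply, backIncl, Fin.succAbove, Fin.lt_def, finCongr_apply,
      Fin.val_cast, Fin.val_natAdd, Fin.val_castSucc, Fin.val_succ]
    split_ifs <;> simp <;> omega
  -- The two terms set apart have the same front and back faces, and occur with signs `(-1)^(p + 1)`
  -- and `(-1)^p`, so they cancel.
  have e5 : ((frontIncl (p := p + 1) (q := q) (n := p + q + 1) (by omega)) ∘
      (Fin.last (p + 1)).succAbove : Fin (p + 1) → Fin (p + q + 2)) =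
        frontIncl (p := p) (q := q + 1) (by omega) := by
    funext k; ext; simp [frontIncl]
  have e6 : ((backIncl (p := p) (q := q + 1) (n := p + q + 1) (by omega)) ∘
      Fin.succAbove 0 : Fin (q + 1) → Fin (p + q + 2)) =
        backIncl (p := p + 1) (q := q) (by omega) := by
    funext k; ext; simp [backIncl]; omega
  have s1 : ∑ i : Fin (p + 1), (-1 : ℤ) ^ (i.castSucc : ℕ) •
      ν (F (frontIncl (p := p + 1) (q := q) (n := p + q + 1) (by omega) ∘ i.castSucc.succAbove))
        (G (backIncl (p := p + 1) (q := q) (n := p + q + 1) (by omega))) =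
      ∑ i : Fin (p + 1), (-1 : ℤ) ^ ((finCongr hN (Fin.castAdd (q + 1) i) : Fin _) : ℕ) •
        ν (F ((finCongr hN (Fin.castAdd (q + 1) i)).succAbove ∘ frontIncl rfl))
          (G ((finCongr hN (Fin.castAdd (q + 1) i)).succAbove ∘ backIncl rfl)) :=
    Finset.sum_congr rfl fun i _ => by rw [e1 i, ← e2 i]; rfl
  have s2 : ∑ j : Fin (q + 1), (-1 : ℤ) ^ (p + (j.succ : ℕ)) •
      ν (F (frontIncl (p := p) (q := q + 1) (n := p + q + 1) (by omega)))
        (G (backIncl (p := p) (q := q + 1) (n := p + q + 1) (by omega) ∘ j.succ.succAbove)) =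
      ∑ j : Fin (q + 1), (-1 : ℤ) ^ ((finCongr hN (Fin.natAdd (p + 1) j) : Fin _) : ℕ) •
        ν (F ((finCongr hN (Fin.natAdd (p + 1) j)).succAbove ∘ frontIncl rfl))
          (G ((finCongr hN (Fin.natAdd (p + 1) j)).succAbove ∘ backIncl rfl)) :=
    Finset.sum_congr rfl fun j _ => by
      rw [e4 j, ← e3 j]
      congr 2
      simp; omega
  rw [← s1, ← s2, e5, e6]
  simp only [Fin.val_last, Fin.val_zero, add_zero, pow_succ, mul_neg, mul_one, neg_smul]
  abel

end Combinatorics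

/-! ### The difference of cup and wedge product as a chain map. -/

section CupSubWedge

variable {V W U : Type*} [NormedAddCommGroup V] [NormedSpace ℝ V]
  [NormedAddCommGroup W] [NormedSpace ℝ W] [NormedAddCommGroup U] [NormedSpace ℝ U]

lemma wedgeAlt_sub_left (β : V →L[ℝ] W →L[ℝ] U) {m p q n : ℕ} (h : p + q = n)
    (a a' : Euc m [⋀^Fin p]→L[ℝ] V) (b : Euc m [⋀^Fin q]→L[ℝ] W) :
    wedgeAlt β h (a - a') b = wedgeAlt β h a b - wedgeAlt β h a' b := by
  simp only [← wedgeCLM_apply, map_sub, _root_.sub_apply]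

lemma wedgeAlt_sub_right (β : V →L[ℝ] W →L[ℝ] U) {m p q n : ℕ} (h : p + q = n)
    (a : Euc m [⋀^Fin p]→L[ℝ] V) (b b' : Euc m [⋀^Fin q]→L[ℝ] W) :
    wedgeAlt β h a (b - b') = wedgeAlt β h a b - wedgeAlt β h a b' := by
  simp only [← wedgeCLM_apply, map_sub]

namespace EForm

lemma cone_sub {n k : ℕ} {a b : EForm n (k + 1) V} (ha : ContDiff ℝ ∞ a) (hb : ContDiff ℝ ∞ b) :
    EForm.cone (a - b) = a.cone - b.cone := by
  refine eq_sub_of_add_eq ?_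
  rw [← cone_add (show ContDiff ℝ ∞ (a - b) from ha.sub hb) hb, sub_add_cancel]

lemma pull_sub {m n k : ℕ} (f : Euc m → Euc n) (a b : EForm n k V) :
    EForm.pull f (a - b) = a.pull f - b.pull f := rfl

end EForm

/-- Additivity is needed for differences because the Poincaré lemma is used as `cone (da) = a - d
(cone a)`. Smoothness guarantees integrability. -/
lemma cupSubWedge_sub_left (β : V →L[ℝ] W →L[ℝ] U) {n p q : ℕ} (h : p + q = n)
    {a a' : EForm n p V} {b : EForm n q W} (ha : ContDiff ℝ ∞ a) (ha' : ContDiff ℝ ∞ a')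
    (hb : ContDiff ℝ ∞ b) :
    cupSubWedge β n h (a - a') b = cupSubWedge β n h a b - cupSubWedge β n h a' b := by
  have h1 : (fun x => wedgeAlt β h ((a - a') x) (b x)) =
      (fun x => wedgeAlt β h (a x) (b x)) - fun x => wedgeAlt β h (a' x) (b x) :=
    funext fun x => wedgeAlt_sub_left β h _ _ _
  simp only [cupSubWedge, h1, EForm.pull_sub]
  rw [EForm.simpInt_sub (contDiff_wedgeAlt β h ha hb).continuous
      (contDiff_wedgeAlt β h ha' hb).continuous,
    EForm.simpInt_sub (EForm.contDiff_pull_simpMap _ ha).continuous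
      (EForm.contDiff_pull_simpMap _ ha').continuous, map_sub, _root_.sub_apply]
  abel

lemma cupSubWedge_sub_right (β : V →L[ℝ] W →L[ℝ] U) {n p q : ℕ} (h : p + q = n)
    {a : EForm n p V} {b b' : EForm n q W} (ha : ContDiff ℝ ∞ a) (hb : ContDiff ℝ ∞ b)
    (hb' : ContDiff ℝ ∞ b') :
    cupSubWedge β n h a (b - b') = cupSubWedge β n h a b - cupSubWedge β n h a b' := by
  have h1 : (fun x => wedgeAlt β h (a x) ((b - b') x)) =
      (fun x => wedgeAlt β h (a x) (b x)) - fun x => wedgeAlt β h (a x) (b' x) :=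
    funext fun x => wedgeAlt_sub_right β h _ _ _
  simp only [cupSubWedge, h1, EForm.pull_sub]
  rw [EForm.simpInt_sub (contDiff_wedgeAlt β h ha hb).continuous
      (contDiff_wedgeAlt β h ha hb').continuous,
    EForm.simpInt_sub (EForm.contDiff_pull_simpMap _ hb).continuous
      (EForm.contDiff_pull_simpMap _ hb').continuous, map_sub]
  abel

variable [CompleteSpace V] [CompleteSpace W] [CompleteSpace U]

/-- Cup product minus wedge product is a chain map. -/
lemma cupSubWedge_extDeriv (β : V →L[ℝ] W →L[ℝ] U) {n p q : ℕ} (h : p + q = n)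
    {a : EForm (n + 1) p V} {b : EForm (n + 1) q W} (ha : ContDiff ℝ ∞ a) (hb : ContDiff ℝ ∞ b) :
    cupSubWedge β (n + 1) (p := p + 1) (q := q) (by omega) (extDeriv a) b +
      (-1 : ℤ) ^ p • cupSubWedge β (n + 1) (p := p) (q := q + 1) (by omega) a (extDeriv b) =
      ∑ i : Fin (n + 2), (-1 : ℤ) ^ (i : ℕ) •
        cupSubWedge β n h (a.pull (simpMap i.succAbove)) (b.pull (simpMap i.succAbove)) := by
  -- The integrals over the faces of the front and back parts are collected by Stokes into integrals
  -- of exterior derivatives.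
  have hcup := sum_faces_cup (fun x y => β x y) (fun x x' y => by simp) (fun x y y' => by simp) h
    (fun θ => (a.pull (simpMap θ)).simpInt) (fun θ => (b.pull (simpMap θ)).simpInt)
  simp only [← EForm.pull_simpMap_simpMap] at hcup
  rw [← EForm.simpInt_extDeriv (EForm.contDiff_pull_simpMap _ ha),
    ← EForm.simpInt_extDeriv (EForm.contDiff_pull_simpMap _ hb),
    EForm.extDeriv_pull_simpMap _ ha, EForm.extDeriv_pull_simpMap _ hb] at hcup
  have hw := contDiff_wedgeAlt β h ha hb
  have hwedge := EForm.simpInt_extDeriv hw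
  have hpull : ∀ i : Fin (n + 2), EForm.pull (simpMap i.succAbove)
      (fun x => wedgeAlt β h (a x) (b x)) = fun x => wedgeAlt β h
        (a.pull (simpMap i.succAbove) x) (b.pull (simpMap i.succAbove) x) := fun i =>
    funext fun x => (wedgeAlt_comp β h _ _ _).symm
  have hd : (extDeriv fun x => wedgeAlt β h (a x) (b x)) =
      (fun x => wedgeAlt β (p := p + 1) (by omega) (extDeriv a x) (b x)) +
        ((-1 : ℤ) ^ p : ℤ) • fun x => wedgeAlt β (q := q + 1) (by omega) (a x) (extDeriv b x) :=
    funext fun x => extDeriv_wedgeAlt β h ha hb x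
  have hz : ∀ c : EForm (n + 1) (n + 1) U, ((-1 : ℤ) ^ p) • c = ((-1 : ℝ) ^ p) • c := fun c => by
    rcases Nat.even_or_odd p with h | h <;> simp [h.neg_one_pow]
  have hz' : ∀ c : U, ((-1 : ℝ) ^ p) • c = ((-1 : ℤ) ^ p) • c := fun c => by
    rcases Nat.even_or_odd p with h | h <;> simp [h.neg_one_pow]
  have hc2 : Continuous fun x => wedgeAlt β (q := q + 1) (n := n + 1) (by omega) (a x)
    (extDeriv b x) := (contDiff_wedgeAlt β _ ha (EForm.contDiff_extDeriv hb)).continuous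
  rw [hd, hz, EForm.simpInt_add (contDiff_wedgeAlt β _ (EForm.contDiff_extDeriv ha) hb).continuous
    (hc2.const_smul ((-1 : ℝ) ^ p)), EForm.simpInt_smul, hz'] at hwedge
  simp only [hpull] at hwedge
  simp only [cupSubWedge, smul_sub, Finset.sum_sub_distrib, ← hcup, ← hwedge]
  abel

end CupSubWedge

/-! ### The homotopy formula, by acyclic models. -/

section Homotopy

variable {V W U : Type*} [NormedAddCommGroup V] [NormedSpace ℝ V]
  [NormedAddCommGroup W] [NormedSpace ℝ W] [NormedAddCommGroup U] [NormedSpace ℝ U]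

lemma extDeriv_const_zeroForm {n : ℕ} (c : Euc n [⋀^Fin 0]→L[ℝ] V) :
    extDeriv (fun _ : Euc n => c) = 0 := by
  funext x
  ext v
  rw [EForm.extDeriv_eq_sum]
  simp

lemma cupWedgeHomotopyAux_zero (β : V →L[ℝ] W →L[ℝ] U) {p q : ℕ} (h : p + q = 0 + 1)
    (a : EForm 0 p V) (b : EForm 0 q W) : cupWedgeHomotopyAux β 0 h a b = 0 := by
  simp [cupWedgeHomotopyAux]

lemma cupWedgeHomotopyAux_succ (β : V →L[ℝ] W →L[ℝ] U) {n p q : ℕ} (h : p + 1 + q = n + 1 + 1)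
    (a : EForm (n + 1) (p + 1) V) (b : EForm (n + 1) q W) :
    cupWedgeHomotopyAux β (n + 1) h a b = cupSubWedge β (n + 1) (by omega) a.cone b -
      ∑ i : Fin (n + 2), (-1 : ℤ) ^ (i : ℕ) •
        cupWedgeHomotopyAux β n (by omega) (a.cone.pull (simpMap i.succAbove))
          (b.pull (simpMap i.succAbove)) := by
  simp [cupWedgeHomotopyAux]

lemma cupWedgeHomotopyAux_succ_zero (β : V →L[ℝ] W →L[ℝ] U) {n q : ℕ}
    (h : 0 + (q + 1) = n + 1 + 1)
    (a : EForm (n + 1) 0 V) (b : EForm (n + 1) (q + 1) W) :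
    cupWedgeHomotopyAux β (n + 1) h a b =
      cupSubWedge β (n + 1) (p := 0) (by omega) (fun _ => a 0) b.cone -
      ∑ i : Fin (n + 2), (-1 : ℤ) ^ (i : ℕ) •
        cupWedgeHomotopyAux β n (p := 0) (by omega)
          (EForm.pull (simpMap i.succAbove) fun _ => a 0) (b.cone.pull (simpMap i.succAbove)) := by
  simp [cupWedgeHomotopyAux]

lemma cupWedgeHomotopyAux_sub_left (β : V →L[ℝ] W →L[ℝ] U) {n p q : ℕ} (h : p + q = n + 1)
    {a a' : EForm n p V} {b : EForm n q W} (ha : ContDiff ℝ ∞ a) (ha' : ContDiff ℝ ∞ a')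
    (hb : ContDiff ℝ ∞ b) :
    cupWedgeHomotopyAux β n h (a - a') b =
      cupWedgeHomotopyAux β n h a b - cupWedgeHomotopyAux β n h a' b := by
  induction n generalizing p q with
  | zero => simp [cupWedgeHomotopyAux_zero]
  | succ n ih =>
    rcases p with _ | p
    · obtain ⟨q, rfl⟩ : ∃ q', q = q' + 1 := ⟨q - 1, by omega⟩
      have hconst : (fun _ : Euc (n + 1) => (a - a') 0) = (fun _ => a 0) - fun _ => a' 0 := rfl
      have hs := EForm.contDiff_cone hb
      have i1 : ∀ i : Fin (n + 2), _ := fun i => ih (p := 0) (q := q) (by omega)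
        (EForm.contDiff_pull_simpMap i.succAbove (a := fun _ => a 0) contDiff_const)
        (EForm.contDiff_pull_simpMap i.succAbove (a := fun _ => a' 0) contDiff_const)
        (EForm.contDiff_pull_simpMap i.succAbove hs)
      simp only [cupWedgeHomotopyAux_succ_zero, hconst, EForm.pull_sub, i1, smul_sub,
        Finset.sum_sub_distrib]
      rw [cupSubWedge_sub_left β _ contDiff_const contDiff_const hs]
      abel
    · have i1 : ∀ i : Fin (n + 2), _ := fun i => ih (p := p) (q := q) (by omega)
        (EForm.contDiff_pull_simpMap i.succAbove (EForm.contDiff_cone ha))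
        (EForm.contDiff_pull_simpMap i.succAbove (EForm.contDiff_cone ha'))
        (EForm.contDiff_pull_simpMap i.succAbove hb)
      simp only [cupWedgeHomotopyAux_succ, EForm.cone_sub ha ha', EForm.pull_sub, i1, smul_sub,
        Finset.sum_sub_distrib]
      rw [cupSubWedge_sub_left β _ (EForm.contDiff_cone ha) (EForm.contDiff_cone ha') hb]
      abel

lemma cupWedgeHomotopyAux_sub_right (β : V →L[ℝ] W →L[ℝ] U) {n p q : ℕ} (h : p + q = n + 1)
    {a : EForm n p V} {b b' : EForm n q W} (ha : ContDiff ℝ ∞ a) (hb : ContDiff ℝ ∞ b)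
    (hb' : ContDiff ℝ ∞ b') :
    cupWedgeHomotopyAux β n h a (b - b') =
      cupWedgeHomotopyAux β n h a b - cupWedgeHomotopyAux β n h a b' := by
  induction n generalizing p q with
  | zero => simp [cupWedgeHomotopyAux_zero]
  | succ n ih =>
    rcases p with _ | p
    · obtain ⟨q, rfl⟩ : ∃ q', q = q' + 1 := ⟨q - 1, by omega⟩
      have i1 : ∀ i : Fin (n + 2), _ := fun i => ih (p := 0) (q := q) (by omega)
        (EForm.contDiff_pull_simpMap i.succAbove (a := fun _ => a 0) contDiff_const)
        (EForm.contDiff_pull_simpMap i.succAbove (EForm.contDiff_cone hb))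
        (EForm.contDiff_pull_simpMap i.succAbove (EForm.contDiff_cone hb'))
      simp only [cupWedgeHomotopyAux_succ_zero, EForm.cone_sub hb hb', EForm.pull_sub, i1, smul_sub,
        Finset.sum_sub_distrib]
      rw [cupSubWedge_sub_right β _ contDiff_const (EForm.contDiff_cone hb)
        (EForm.contDiff_cone hb')]
      abel
    · have i1 : ∀ i : Fin (n + 2), _ := fun i => ih (p := p) (q := q) (by omega)
        (EForm.contDiff_pull_simpMap i.succAbove (EForm.contDiff_cone ha))
        (EForm.contDiff_pull_simpMap i.succAbove hb)
        (EForm.contDiff_pull_simpMap i.succAbove hb')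
      simp only [cupWedgeHomotopyAux_succ, EForm.pull_sub, i1, smul_sub, Finset.sum_sub_distrib]
      rw [cupSubWedge_sub_right β _ (EForm.contDiff_cone ha) hb hb']
      abel

lemma cupWedgeHomotopyAux_zero_left (β : V →L[ℝ] W →L[ℝ] U) {n p q : ℕ} (h : p + q = n + 1)
    {b : EForm n q W} (hb : ContDiff ℝ ∞ b) : cupWedgeHomotopyAux β n h 0 b = 0 := by
  have := cupWedgeHomotopyAux_sub_left β h (a := 0) (a' := 0) contDiff_const contDiff_const hb
  rwa [sub_self, sub_self] at this

lemma cupSubWedge_zero_left (β : V →L[ℝ] W →L[ℝ] U) {n p q : ℕ} (h : p + q = n)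
    {b : EForm n q W} (hb : ContDiff ℝ ∞ b) : cupSubWedge β n h 0 b = 0 := by
  have := cupSubWedge_sub_left β h (a := 0) (a' := 0) contDiff_const contDiff_const hb
  rwa [sub_self, sub_self] at this

variable [CompleteSpace V] [CompleteSpace W] [CompleteSpace U]

/-- On a point both products are the pairing of the two values; this starts the acyclic models
induction. -/
lemma cupSubWedge_zero_zero (β : V →L[ℝ] W →L[ℝ] U) {p q : ℕ} (h : p + q = 0)
    (a : EForm 0 p V) (b : EForm 0 q W) : cupSubWedge β 0 h a b = 0 := by
  obtain rfl : p = 0 := by omega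
  obtain rfl : q = 0 := by omega
  simp only [cupSubWedge, EForm.simpInt_zero, EForm.pull_simpMap, wedgeAlt_apply,
    ContinuousAlternatingMap.compContinuousLinearMap_apply]
  obtain ⟨c, hc⟩ : ∃ c, ∀ x v, a x v = c :=
    ⟨a 0 0, fun x v => by rw [Subsingleton.elim x 0, Subsingleton.elim v 0]⟩
  obtain ⟨e, he⟩ : ∃ e, ∀ x v, b x v = e :=
    ⟨b 0 0, fun x v => by rw [Subsingleton.elim x 0, Subsingleton.elim v 0]⟩
  simp [hc, he]

/-- If the homotopy formula holds up to boundaries in one dimension, it holds in the next one. -/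
lemma cupWedgeHomotopyAux_step (β : V →L[ℝ] W →L[ℝ] U) {n : ℕ}
    (Q : ∀ {p q : ℕ} (h : p + q = n) (a : EForm (n + 1) p V) (b : EForm (n + 1) q W),
      ContDiff ℝ ∞ a → ContDiff ℝ ∞ b →
      ∑ i : Fin (n + 2), (-1 : ℤ) ^ (i : ℕ) •
        (cupWedgeHomotopyAux β n (p := p + 1) (q := q) (by omega)
          (extDeriv (a.pull (simpMap i.succAbove))) (b.pull (simpMap i.succAbove)) +
        (-1 : ℤ) ^ p • cupWedgeHomotopyAux β n (p := p) (q := q + 1) (by omega)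
          (a.pull (simpMap i.succAbove)) (extDeriv (b.pull (simpMap i.succAbove)))) =
      ∑ i : Fin (n + 2), (-1 : ℤ) ^ (i : ℕ) •
        cupSubWedge β n h (a.pull (simpMap i.succAbove)) (b.pull (simpMap i.succAbove)))
    {p q : ℕ} (h : p + q = n + 1) {a : EForm (n + 1) p V} {b : EForm (n + 1) q W}
    (ha : ContDiff ℝ ∞ a) (hb : ContDiff ℝ ∞ b) :
    ∑ i : Fin (n + 2), (-1 : ℤ) ^ (i : ℕ) • cupWedgeHomotopyAux β n h
        (a.pull (simpMap i.succAbove)) (b.pull (simpMap i.succAbove)) +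
      (cupWedgeHomotopyAux β (n + 1) (p := p + 1) (q := q) (by omega) (extDeriv a) b +
      (-1 : ℤ) ^ p • cupWedgeHomotopyAux β (n + 1) (p := p) (q := q + 1) (by omega)
        a (extDeriv b)) =
      cupSubWedge β (n + 1) h a b := by
  have hP : ∀ {k : ℕ} (i : Fin (n + 2)) {c : EForm (n + 1) k V}, ContDiff ℝ ∞ c →
      ContDiff ℝ ∞ (c.pull (simpMap i.succAbove)) := fun i _ hc => EForm.contDiff_pull_simpMap _ hc
  have hP' : ∀ {k : ℕ} (i : Fin (n + 2)) {c : EForm (n + 1) k W}, ContDiff ℝ ∞ c →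
      ContDiff ℝ ∞ (c.pull (simpMap i.succAbove)) := fun i _ hc => EForm.contDiff_pull_simpMap _ hc
  -- The contraction `S` differs in the two cases. For `p = 0` it sends `a ⊗ b` to `a(0) ⊗ cone b`,
  -- so `SD(a ⊗ b) = (a - a(0)) ⊗ b + a(0) ⊗ (b - d (cone b))`; otherwise it sends `a ⊗ b` to `cone
  -- a ⊗ b`. Either way `SD = 1 - DS`.
  rcases p with _ | p
  · obtain ⟨q, rfl⟩ : ∃ q', q = q' + 1 := ⟨q - 1, by omega⟩
    have hs := EForm.contDiff_cone hb
    have hc : ContDiff ℝ ∞ (fun _ : Euc (n + 1) => a 0) := contDiff_const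
    have h1 : EForm.cone (extDeriv a) = a - fun _ => a 0 := EForm.cone_extDeriv_zero ha
    have h2 : EForm.cone (extDeriv b) = b - extDeriv b.cone :=
      eq_sub_of_add_eq' (EForm.extDeriv_cone_add_cone_extDeriv hb)
    -- `hT` evaluates cup minus wedge on `D S (a ⊗ b)` and `hQ` evaluates the boundary of the
    -- homotopy on it; both are the same alternating sum, so they cancel.
    have hT := cupSubWedge_extDeriv β (p := 0) (q := q) (by omega) hc hs
    rw [extDeriv_const_zeroForm, cupSubWedge_zero_left β _ hs] at hT
    have hQ := Q (p := 0) (q := q) (by omega) _ _ hc hs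
    have hz : ∀ i : Fin (n + 2), extDeriv (EForm.pull (simpMap i.succAbove)
        (fun _ : Euc (n + 1) => a 0)) = 0 := fun i => by
      rw [EForm.extDeriv_pull_simpMap _ hc, extDeriv_const_zeroForm]
      funext x; ext; simp [EForm.pull]
    have hz' : ∀ i : Fin (n + 2), _ := fun i =>
      cupWedgeHomotopyAux_zero_left β (n := n) (p := 0 + 1) (q := q) (by omega) (hP' i hs)
    simp only [hz, hz'] at hQ
    have l1 : ∀ i : Fin (n + 2), _ := fun i =>
      cupWedgeHomotopyAux_sub_left β (n := n) (p := 0) (q := q + 1) (by omega)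
        (hP i ha) (hP i hc) (hP' i hb)
    have l2 : ∀ i : Fin (n + 2), _ := fun i =>
      cupWedgeHomotopyAux_sub_right β (n := n) (p := 0) (q := q + 1) (by omega)
        (hP i hc) (hP' i hb) (EForm.contDiff_extDeriv (hP' i hs))
    rw [cupWedgeHomotopyAux_succ, cupWedgeHomotopyAux_succ_zero, h1, h2]
    simp only [EForm.pull_sub, ← EForm.extDeriv_pull_simpMap _ hs, l1, l2]
    rw [cupSubWedge_sub_left β _ ha hc hb,
      cupSubWedge_sub_right β _ hc hb (EForm.contDiff_extDeriv hs)]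
    simp only [pow_zero, one_smul, zero_add] at hT hQ ⊢
    rw [hT, ← hQ]
    simp only [smul_sub, Finset.sum_sub_distrib]
    abel
  · have hs := EForm.contDiff_cone ha
    have h1 : EForm.cone (extDeriv a) = a - extDeriv a.cone :=
      eq_sub_of_add_eq' (EForm.extDeriv_cone_add_cone_extDeriv ha)
    have hT := cupSubWedge_extDeriv β (p := p) (q := q) (by omega) hs hb
    have hQ := Q (p := p) (q := q) (by omega) _ _ hs hb
    have l1 : ∀ i : Fin (n + 2), _ := fun i =>
      cupWedgeHomotopyAux_sub_left β (n := n) (p := p + 1) (q := q) (by omega)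
        (hP i ha) (EForm.contDiff_extDeriv (hP i hs)) (hP' i hb)
    rw [cupWedgeHomotopyAux_succ, cupWedgeHomotopyAux_succ, h1]
    simp only [EForm.pull_sub, ← EForm.extDeriv_pull_simpMap _ hs,
      ← EForm.extDeriv_pull_simpMap _ hb, l1]
    rw [cupSubWedge_sub_left β _ ha (EForm.contDiff_extDeriv hs) hb]
    rw [← hQ] at hT
    simp only [smul_add, Finset.sum_add_distrib, smul_comm _ ((-1 : ℤ) ^ p),
      ← Finset.smul_sum] at hT
    simp only [smul_sub, Finset.sum_sub_distrib, pow_succ, mul_neg, mul_one, neg_smul]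
    have hT' := eq_sub_of_add_eq hT
    rw [hT']
    abel

/-- The homotopy formula for the natural chain homotopy between cup and wedge product. -/
lemma cupWedgeHomotopyAux_extDeriv (β : V →L[ℝ] W →L[ℝ] U) {n p q : ℕ} (h : p + q = n + 1)
    {a : EForm (n + 1) p V} {b : EForm (n + 1) q W} (ha : ContDiff ℝ ∞ a) (hb : ContDiff ℝ ∞ b) :
    ∑ i : Fin (n + 2), (-1 : ℤ) ^ (i : ℕ) • cupWedgeHomotopyAux β n h
        (a.pull (simpMap i.succAbove)) (b.pull (simpMap i.succAbove)) +
      (cupWedgeHomotopyAux β (n + 1) (p := p + 1) (q := q) (by omega) (extDeriv a) b +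
      (-1 : ℤ) ^ p • cupWedgeHomotopyAux β (n + 1) (p := p) (q := q + 1) (by omega)
        a (extDeriv b)) =
      cupSubWedge β (n + 1) h a b := by
  induction n generalizing p q with
  | zero =>
    refine cupWedgeHomotopyAux_step β (fun h a b _ _ => ?_) h ha hb
    simp only [cupWedgeHomotopyAux_zero, cupSubWedge_zero_zero, smul_zero, add_zero]
  | succ n ih =>
    refine cupWedgeHomotopyAux_step β (fun {p q} h a b ha hb => ?_) h ha hb
    have hi : ∀ i : Fin (n + 3), _ := fun i => ih (p := p) (q := q) (by omega)
      (EForm.contDiff_pull_simpMap i.succAbove ha) (EForm.contDiff_pull_simpMap i.succAbove hb)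
    simp only [← hi, smul_add, Finset.sum_add_distrib, EForm.pull_simpMap_simpMap]
    -- The formula on each face has an extra boundary term; summed over faces it is a double
    -- boundary and vanishes.
    rw [sum_sum_succAbove_succAbove fun θ => cupWedgeHomotopyAux β n h (a.pull (simpMap θ))
      (b.pull (simpMap θ)), zero_add]

end Homotopy

/-! ### Dependence on values on the closed simplex only. -/

section Simplex

lemma zero_mem_stdSimp (n : ℕ) : (0 : Euc n) ∈ stdSimp n := by simp [stdSimp]

lemma smul_mem_stdSimp {n : ℕ} {x : Euc n} (hx : x ∈ stdSimp n) {t : ℝ} (ht : t ∈ Set.Icc 0 1) :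
    t • x ∈ stdSimp n := by
  have := convex_stdSimp n (zero_mem_stdSimp n) hx (sub_nonneg.2 ht.2) ht.1 (by ring)
  simpa using this

/-- A convex set with nonempty interior lies in the closure of that interior; the witness is the
point with all barycentric coordinates `1 / (n + 1)`. -/
lemma stdSimp_subset_closure_interior (n : ℕ) : stdSimp n ⊆ closure (interior (stdSimp n)) := by
  have hne : (interior (stdSimp n)).Nonempty := by
    refine ⟨WithLp.toLp 2 fun _ => ((n : ℝ) + 1)⁻¹, mem_interior.2
      ⟨{x | (∀ i, 0 < x i) ∧ ∑ i, x i < 1}, fun x hx => ⟨fun i => (hx.1 i).le, hx.2.le⟩, ?_, ?_⟩⟩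
    · have : {x : Euc n | (∀ i, 0 < x i) ∧ ∑ i, x i < 1} =
          (⋂ i, {x : Euc n | 0 < x i}) ∩ {x | ∑ i, x i < 1} := by
        ext; simp
      rw [this]
      exact (isOpen_iInter_of_finite fun i => isOpen_lt (by fun_prop) (by fun_prop)).inter
        (isOpen_lt (by fun_prop) (by fun_prop))
    · refine ⟨fun i => by positivity, ?_⟩
      have : (n : ℝ) * ((n : ℝ) + 1)⁻¹ < 1 := by
        rw [← div_eq_mul_inv, div_lt_one (by positivity)]
        linarith
      simpa using this
  rw [(convex_stdSimp n).closure_interior_eq_closure_of_nonempty_interior hne]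
  exact subset_closure

end Simplex

namespace EForm

variable {V W U : Type*} [NormedAddCommGroup V] [NormedSpace ℝ V]
  [NormedAddCommGroup W] [NormedSpace ℝ W] [NormedAddCommGroup U] [NormedSpace ℝ U]

lemma pull_simpMap_eqOn {m n k : ℕ} (θ : Fin (m + 1) → Fin (n + 1)) {a b : EForm n k V}
    (h : Set.EqOn a b (stdSimp n)) :
    Set.EqOn (a.pull (simpMap θ)) (b.pull (simpMap θ)) (stdSimp m) := fun x hx => by
  rw [pull_simpMap, pull_simpMap, h (simpMap_mem θ hx)]

/-- The simplex is star-shaped about `0`, so the contraction at a point of it uses only values on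
it. -/
lemma cone_eqOn {n k : ℕ} {a b : EForm n (k + 1) V} (h : Set.EqOn a b (stdSimp n)) :
    Set.EqOn a.cone b.cone (stdSimp n) := fun x hx => by
  refine intervalIntegral.integral_congr fun t ht => ?_
  rw [Set.uIcc_of_le zero_le_one] at ht
  simp only [h (smul_mem_stdSimp hx ht)]

lemma cupSubWedge_congr (β : V →L[ℝ] W →L[ℝ] U) {n p q : ℕ} (h : p + q = n)
    {a a' : EForm n p V} {b b' : EForm n q W} (ha : Set.EqOn a a' (stdSimp n))
    (hb : Set.EqOn b b' (stdSimp n)) : cupSubWedge β n h a b = cupSubWedge β n h a' b' := by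
  have h1 : EForm.simpInt (fun x => wedgeAlt β h (a x) (b x)) =
      EForm.simpInt fun x => wedgeAlt β h (a' x) (b' x) :=
    simpInt_congr fun x hx => by simp only [ha hx, hb hx]
  rw [cupSubWedge, cupSubWedge, simpInt_congr (pull_simpMap_eqOn _ ha),
    simpInt_congr (pull_simpMap_eqOn _ hb), h1]

lemma cupWedgeHomotopyAux_congr (β : V →L[ℝ] W →L[ℝ] U) {n p q : ℕ} (h : p + q = n + 1)
    {a a' : EForm n p V} {b b' : EForm n q W} (ha : Set.EqOn a a' (stdSimp n))
    (hb : Set.EqOn b b' (stdSimp n)) :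
    cupWedgeHomotopyAux β n h a b = cupWedgeHomotopyAux β n h a' b' := by
  induction n generalizing p q with
  | zero => rw [cupWedgeHomotopyAux_zero, cupWedgeHomotopyAux_zero]
  | succ n ih =>
    rcases p with _ | p
    · obtain ⟨q, rfl⟩ : ∃ q', q = q' + 1 := ⟨q - 1, by omega⟩
      have hc : Set.EqOn (fun _ : Euc (n + 1) => a 0) (fun _ => a' 0) (stdSimp (n + 1)) :=
        fun _ _ => ha (zero_mem_stdSimp _)
      rw [cupWedgeHomotopyAux_succ_zero, cupWedgeHomotopyAux_succ_zero,
        cupSubWedge_congr β _ hc (cone_eqOn hb)]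
      congr 1
      exact Finset.sum_congr rfl fun i _ => by
        rw [ih (p := 0) (by omega) (pull_simpMap_eqOn _ hc) (pull_simpMap_eqOn _ (cone_eqOn hb))]
    · rw [cupWedgeHomotopyAux_succ, cupWedgeHomotopyAux_succ,
        cupSubWedge_congr β _ (cone_eqOn ha) hb]
      congr 1
      exact Finset.sum_congr rfl fun i _ => by
        rw [ih (by omega) (pull_simpMap_eqOn _ (cone_eqOn ha)) (pull_simpMap_eqOn _ hb)]

end EForm

/-! ### Independence of the chosen extensions, and naturality on diffeological spaces. -/

section PlotIndependence

variable {X Y : Type*} [DiffeologicalSpace X] [DiffeologicalSpace Y]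
  {V W U : Type*} [NormedAddCommGroup V] [NormedSpace ℝ V]
  [NormedAddCommGroup W] [NormedSpace ℝ W] [NormedAddCommGroup U] [NormedSpace ℝ U]

namespace DForm

lemma toFun_congr {k n : ℕ} (a : DForm X k V) {p p' : Euc n → X} (h : p = p') (hp : IsPlot p)
    (hp' : IsPlot p') : a.toFun n p hp = a.toFun n p' hp' := by
  subst h; rfl

/-- Precomposition with a diffeomorphism from the whole space onto the ball makes the two plots
equal. Naturality then identifies the pulled back forms, and the derivative of the diffeomorphism at
the centre is invertible. -/
lemma toFun_eq_of_eqOn_ball {k n : ℕ} (a : DForm X k V) {p p' : Euc n → X} (hp : IsPlot p)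
    (hp' : IsPlot p') {x : Euc n} {r : ℝ} (hr : 0 < r) (h : Set.EqOn p p' (Metric.ball x r)) :
    a.toFun n p hp x = a.toFun n p' hp' x := by
  set e := OpenPartialHomeomorph.univBall x r with he
  have h0 : e 0 = x := OpenPartialHomeomorph.univBall_apply_zero x r
  have hsymm : e.symm x = 0 := OpenPartialHomeomorph.univBall_symm_apply_center x r
  have hsm : ContDiff ℝ ∞ e := OpenPartialHomeomorph.contDiff_univBall
  have hmem : ∀ y, e y ∈ Metric.ball x r := fun y => by
    have := e.map_source (x := y)
    rw [OpenPartialHomeomorph.univBall_source, OpenPartialHomeomorph.univBall_target x hr] at this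
    exact this trivial
  have hcomp : p ∘ e = p' ∘ e := funext fun y => h (hmem y)
  have h1 := toFun_congr a hcomp (isPlot_reparam hp hsm) (isPlot_reparam hp' hsm)
  rw [a.natural' _ _ _ hp _ hsm, a.natural' _ _ _ hp' _ hsm] at h1
  have h2 := congrFun h1 0
  simp only [EForm.pull, h0] at h2
  have hball := Metric.ball_mem_nhds x hr
  have hdsymm : DifferentiableAt ℝ e.symm x :=
    ((OpenPartialHomeomorph.contDiffOn_univBall_symm (n := ⊤) (c := x) (r := r)).contDiffAt
      hball).differentiableAt (by simp)
  have hde : HasFDerivAt e (fderiv ℝ e 0) (e.symm x) := by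
    rw [hsymm]
    exact (hsm.differentiable (by simp) 0).hasFDerivAt
  have hid : HasFDerivAt (e ∘ e.symm) (ContinuousLinearMap.id ℝ (Euc n)) x := by
    refine (hasFDerivAt_id x).congr_of_eventuallyEq ?_
    filter_upwards [hball] with y hy
    rw [← OpenPartialHomeomorph.univBall_target x hr] at hy
    exact e.right_inv hy
  have hright := (hde.comp x hdsymm.hasFDerivAt).unique hid
  ext v
  have h3 := congrArg (fun A => A fun i => fderiv ℝ e.symm x (v i)) h2
  have h4 : ∀ w, fderiv ℝ e 0 (fderiv ℝ e.symm x w) = w := fun w => DFunLike.congr_fun hright w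
  simpa only [ContinuousAlternatingMap.compContinuousLinearMap_apply, Function.comp_def, h4]
    using h3

/-- Plots that agree only on the simplex may differ arbitrarily close to its boundary points. The
forms agree in the interior by locality, and on the boundary by continuity. -/
lemma toFun_eqOn {k n : ℕ} (a : DForm X k V) {p p' : Euc n → X} (hp : IsPlot p)
    (hp' : IsPlot p') (h : Set.EqOn p p' (stdSimp n)) :
    Set.EqOn (a.toFun n p hp) (a.toFun n p' hp') (stdSimp n) := by
  have hint : Set.EqOn (a.toFun n p hp) (a.toFun n p' hp') (interior (stdSimp n)) := by
    intro x hx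
    obtain ⟨r, hr, hball⟩ := Metric.isOpen_iff.1 isOpen_interior x hx
    exact toFun_eq_of_eqOn_ball a hp hp' hr
      fun y hy => h (interior_subset (hball hy))
  exact (hint.closure (a.smooth' n p hp).continuous (a.smooth' n p' hp').continuous).mono
    (stdSimp_subset_closure_interior n)

/-- The form on the simplex may be computed with any extension. -/
lemma toFun_extension_eqOn {k n : ℕ} (a : DForm X k V) (s : SmoothSimplex X n) {p : Euc n → X}
    (hp : IsPlot p) (h : ∀ x : stdSimp n, p x = s.toFun x) :
    Set.EqOn (a.toFun n s.extension s.isPlot_extension) (a.toFun n p hp) (stdSimp n) :=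
  toFun_eqOn a _ _ fun x hx => (s.extension_apply ⟨x, hx⟩).trans (h ⟨x, hx⟩).symm

lemma toFun_restrict_eqOn {k m n : ℕ} (a : DForm X k V) (s : SmoothSimplex X n)
    (θ : Fin (m + 1) → Fin (n + 1)) :
    Set.EqOn (a.toFun m (s.restrict θ).extension (s.restrict θ).isPlot_extension)
      ((a.toFun n s.extension s.isPlot_extension).pull (simpMap θ)) (stdSimp m) := by
  rw [← a.natural' m n _ s.isPlot_extension _ (contDiff_simpMap θ)]
  exact toFun_extension_eqOn a _ _ fun x => s.extension_apply ⟨simpMap θ x, simpMap_mem θ x.2⟩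

lemma toFun_map_eqOn {k n : ℕ} (a : DForm Y k V) (f : X → Y) (hf : DSmooth f)
    (s : SmoothSimplex X n) :
    Set.EqOn (a.toFun n (s.map f hf).extension (s.map f hf).isPlot_extension)
      ((a.pullback f hf).toFun n s.extension s.isPlot_extension) (stdSimp n) :=
  toFun_extension_eqOn a _ _ fun x => congrArg f (s.extension_apply x)

lemma toCochain_pullback {n : ℕ} (a : DForm Y n V) (f : X → Y) (hf : DSmooth f)
    (s : SmoothSimplex X n) : (a.pullback f hf).toCochain s = a.toCochain (s.map f hf) :=
  (EForm.simpInt_congr (toFun_map_eqOn a f hf s)).symm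

lemma toCochain_restrict {m n : ℕ} (a : DForm X m V) (s : SmoothSimplex X n)
    (θ : Fin (m + 1) → Fin (n + 1)) : a.toCochain (s.restrict θ) =
      ((a.toFun n s.extension s.isPlot_extension).pull (simpMap θ)).simpInt :=
  EForm.simpInt_congr (toFun_restrict_eqOn a s θ)

/-- Stokes' theorem for smooth singular simplices. -/
lemma toCochain_d [CompleteSpace V] {n : ℕ} (a : DForm X n V) :
    a.d.toCochain = coboundary a.toCochain := by
  funext s
  refine (EForm.simpInt_extDeriv (a.smooth' _ _ s.isPlot_extension)).trans ?_
  exact Finset.sum_congr rfl fun i _ => by rw [← toCochain_restrict]; rfl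

lemma d_wedge (β : V →L[ℝ] W →L[ℝ] U) {p q n : ℕ} (h : p + q = n) (a : DForm X p V)
    (b : DForm X q W) : (DForm.wedge β h a b).d =
      DForm.wedge β (p := p + 1) (by omega) a.d b +
        (-1 : ℤ) ^ p • DForm.wedge β (q := q + 1) (by omega) a b.d := by
  -- Integer multiples of forms are defined by recursion, so the pointwise formula is checked for
  -- the two values `1` and `-1` of the sign.
  have hs : ∀ (c : DForm X (n + 1) U) (m : ℕ) (r : Euc m → X) (hr : IsPlot r) (x : Euc m),
      ((-1 : ℤ) ^ p • c).toFun m r hr x = (-1 : ℤ) ^ p • c.toFun m r hr x := by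
    intro c m r hr x
    rcases Nat.even_or_odd p with h | h
    · simp [h.neg_one_pow]
    · simp only [h.neg_one_pow, neg_smul, one_smul]; rfl
  ext1
  funext m r hr x
  rw [toFun_add, Pi.add_apply, hs]
  exact extDeriv_wedgeAlt β h (a.smooth' _ _ hr) (b.smooth' _ _ hr) x

end DForm

lemma cupWedgeHomotopy_pullback (β : V →L[ℝ] W →L[ℝ] U) {p q n : ℕ} (h : p + q = n + 1)
    (a : DForm Y p V) (b : DForm Y q W) (f : X → Y) (hf : DSmooth f) (s : SmoothSimplex X n) :
    cupWedgeHomotopy β h (a.pullback f hf) (b.pullback f hf) s =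
      cupWedgeHomotopy β h a b (s.map f hf) :=
  (EForm.cupWedgeHomotopyAux_congr β h (a.toFun_map_eqOn f hf s) (b.toFun_map_eqOn f hf s)).symm

/-- The formula on Euclidean space is applied to the chosen extension of the simplex. Each face has
its own chosen extension, which may be replaced by the restricted one. -/
lemma coboundary_cupWedgeHomotopy [CompleteSpace V] [CompleteSpace W] [CompleteSpace U]
    (β : V →L[ℝ] W →L[ℝ] U) {p q n : ℕ} (h : p + q = n + 1) (a : DForm X p V) (b : DForm X q W) :
    coboundary (cupWedgeHomotopy β h a b) +
      (cupWedgeHomotopy β (p := p + 1) (q := q) (by omega) a.d b +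
        (-1 : ℤ) ^ p • cupWedgeHomotopy β (p := p) (q := q + 1) (by omega) a b.d) =
      cupCochain (fun x y => β x y) h a.toCochain b.toCochain - (DForm.wedge β h a b).toCochain := by
  funext s
  have key := cupWedgeHomotopyAux_extDeriv β h (a.smooth' _ _ s.isPlot_extension)
    (b.smooth' _ _ s.isPlot_extension)
  have hcup : cupSubWedge β (n + 1) h (a.toFun _ _ s.isPlot_extension)
      (b.toFun _ _ s.isPlot_extension) =
      cupCochain (fun x y => β x y) h a.toCochain b.toCochain s -
        (DForm.wedge β h a b).toCochain s := by
    rw [cupSubWedge, cupCochain, DForm.toCochain_restrict, DForm.toCochain_restrict]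
    rfl
  have hface : coboundary (cupWedgeHomotopy β h a b) s =
      ∑ i : Fin (n + 2), (-1 : ℤ) ^ (i : ℕ) • cupWedgeHomotopyAux β n h
        ((a.toFun _ _ s.isPlot_extension).pull (simpMap i.succAbove))
        ((b.toFun _ _ s.isPlot_extension).pull (simpMap i.succAbove)) :=
    Finset.sum_congr rfl fun i _ => congrArg _
      (EForm.cupWedgeHomotopyAux_congr β h (a.toFun_restrict_eqOn s i.succAbove)
        (b.toFun_restrict_eqOn s i.succAbove))
  rw [hcup, ← hface] at key
  exact key

end PlotIndependence

/-! ### The cup product of singular cochains. -/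

section CupCochain

variable {X Y : Type*} [DiffeologicalSpace X] [DiffeologicalSpace Y]

lemma SmoothSimplex.restrict_restrict {l m n : ℕ} (s : SmoothSimplex X n)
    (θ : Fin (m + 1) → Fin (n + 1)) (φ : Fin (l + 1) → Fin (m + 1)) :
    (s.restrict θ).restrict φ = s.restrict (θ ∘ φ) := by
  ext x
  exact congrArg s.toFun (Subtype.ext (simpMap_simpMap θ φ x))

variable {A B C : Type*} [AddCommGroup A] [AddCommGroup B] [AddCommGroup C]

lemma coboundary_add {n : ℕ} (a b : Cochain X n A) :
    coboundary (a + b) = coboundary a + coboundary b := by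
  funext s
  simp [coboundary, Finset.sum_add_distrib]

lemma coboundary_zsmul {n : ℕ} (c : ℤ) (a : Cochain X n A) :
    coboundary (c • a) = c • coboundary a := by
  funext s
  simp only [coboundary, Pi.smul_apply, smul_comm _ c, Finset.smul_sum]

/-- The Leibniz rule for the cup product. -/
lemma coboundary_cupCochain (μ : A → B → C) (hl : ∀ a a' b, μ (a + a') b = μ a b + μ a' b)
    (hr : ∀ a b b', μ a (b + b') = μ a b + μ a b') {p q n : ℕ} (h : p + q = n)
    (a : Cochain X p A) (b : Cochain X q B) :
    coboundary (cupCochain μ h a b) =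
      cupCochain μ (p := p + 1) (q := q) (by omega) (coboundary a) b +
        (-1 : ℤ) ^ p • cupCochain μ (p := p) (q := q + 1) (by omega) a (coboundary b) := by
  funext s
  have key := sum_faces_cup μ hl hr h (fun θ => a (s.restrict θ)) (fun θ => b (s.restrict θ))
  simp only [← SmoothSimplex.restrict_restrict] at key
  exact key.symm

end CupCochain

/-! ### Naturality and the Leibniz rule for differential cochains. -/

namespace DiffCochain

variable {V : Type*} [NormedAddCommGroup V] [NormedSpace ℝ V] {Λ : Submodule ℤ V}
  {X Y Z : Type*} [DiffeologicalSpace X] [DiffeologicalSpace Y] [DiffeologicalSpace Z] {k l m : ℕ}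

lemma d_apply (x : DiffCochain Λ X k) :
    x.d = (coboundary x.1, (fun s => (x.1 s : V)) - x.2.2.toCochain - coboundary x.2.1,
      x.2.2.d) := rfl

lemma pullback_congr {f g : X → Y} (h : f = g) (hf : DSmooth f) (hg : DSmooth g)
    (x : DiffCochain Λ Y k) : x.pullback f hf = x.pullback g hg := by
  subst h; rfl

lemma pullback_sub (f : X → Y) (hf : DSmooth f) (x y : DiffCochain Λ Y k) :
    pullback f hf (x - y) = x.pullback f hf - y.pullback f hf := rfl

lemma pullback_zero (f : X → Y) (hf : DSmooth f) : pullback f hf (0 : DiffCochain Λ Y k) = 0 := rfl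

/-- Only the integration cochain in the middle component is not definitional: the image of a simplex
carries an extension chosen independently of that of the simplex. -/
lemma d_pullback (f : X → Y) (hf : DSmooth f) (x : DiffCochain Λ Y k) :
    (x.pullback f hf).d = x.d.pullback f hf := by
  refine Prod.ext rfl (Prod.ext ?_ rfl)
  funext s
  exact congrArg (fun v => (x.1 (s.map f hf) : V) - v - _) (x.2.2.toCochain_pullback f hf s)

lemma pairing_pullback (hm : k + l + 1 = m) (f : X → Y) (hf : DSmooth f) (x : DiffCochain Λ Y k)
    (y : DiffCochain (dualLattice Λ) Y l) :
    (x.pairing hm y).pullback f hf = (x.pullback f hf).pairing hm (y.pullback f hf) := by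
  refine Prod.ext rfl (Prod.ext ?_ rfl)
  funext s
  change ((-1 : ℤ) ^ (k + 1) • _ + _ + _ : ℝ) = (-1 : ℤ) ^ (k + 1) • _ + _ + _
  congr 1
  · congr 1
    exact congrArg (vectorPairing V _) (y.2.2.toCochain_pullback f hf
      (s.restrict (backIncl (p := k) (q := l + 1) hm))).symm
  · exact (cupWedgeHomotopy_pullback _ _ _ _ f hf s).symm

lemma pairing_zero (hm : k + l + 1 = m) (x : DiffCochain Λ X k) :
    x.pairing hm (0 : DiffCochain (dualLattice Λ) X l) = 0 := by
  have h0 : ∀ n : ℕ, (0 : DForm X n (V →L[ℝ] ℝ)).toCochain = 0 := fun n => by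
    have := DForm.toCochain_add (0 : DForm X n (V →L[ℝ] ℝ)) 0
    rwa [add_zero, left_eq_add] at this
  refine Prod.ext ?_ (Prod.ext ?_ ?_)
  · funext s
    exact Subtype.ext rfl
  · funext s
    have hB : cupWedgeHomotopy (vectorPairing V) (n := m) (by omega) x.2.2
        (0 : DForm X (l + 1) (V →L[ℝ] ℝ)) s = 0 := by
      have := cupWedgeHomotopyAux_sub_right (vectorPairing V) (n := m) (p := k + 1) (q := l + 1)
        (by omega) (b := 0) (b' := 0) (x.2.2.smooth' _ _ s.isPlot_extension)
        contDiff_const contDiff_const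
      rwa [sub_self, sub_self] at this
    simp only [DiffCochain.pairing, Prod.fst_zero, Prod.snd_zero, Pi.add_apply, Pi.smul_apply, hB,
      h0, cupCochain, Pi.zero_apply, map_zero, smul_zero, add_zero]
  · ext1
    funext n p hp u
    change wedgeCLM (vectorPairing V) _ _ 0 = 0
    rw [map_zero]

lemma zero_pairing (hm : k + l + 1 = m) (y : DiffCochain (dualLattice Λ) X l) :
    (0 : DiffCochain Λ X k).pairing hm y = 0 := by
  refine Prod.ext ?_ (Prod.ext ?_ ?_)
  · funext s
    exact Subtype.ext (by simp [DiffCochain.pairing, cupCochain, latticePairing])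
  · funext s
    have hB : cupWedgeHomotopy (vectorPairing V) (n := m) (by omega)
        (0 : DForm X (k + 1) V) y.2.2 s = 0 :=
      cupWedgeHomotopyAux_zero_left _ _ (y.2.2.smooth' _ _ s.isPlot_extension)
    simp only [DiffCochain.pairing, Prod.fst_zero, Prod.snd_zero, Pi.add_apply, Pi.smul_apply, hB,
      cupCochain, Pi.zero_apply, map_zero, _root_.zero_apply, smul_zero, add_zero,
      ZeroMemClass.coe_zero]
  · ext1
    funext n p hp u
    change wedgeCLM (vectorPairing V) _ 0 _ = 0
    rw [map_zero]
    rfl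

/-- The Leibniz rule for the pairing of differential cochains. -/
lemma d_pairing [FiniteDimensional ℝ V] (hm : k + l + 1 = m) (x : DiffCochain Λ X k)
    (y : DiffCochain (dualLattice Λ) X l) :
    (x.pairing hm y).d = x.d.pairing (k := k + 1) (l := l) (by omega) y +
      (-1 : ℤ) ^ (k + 1) • x.pairing (k := k) (l := l + 1) (by omega) y.d := by
  have : CompleteSpace V := FiniteDimensional.complete ℝ V
  have hD := coboundary_cupWedgeHomotopy (vectorPairing V) (n := m) (by omega) x.2.2 y.2.2
  have hA := coboundary_cupCochain (fun (c : Λ) h => vectorPairing V c h) (by simp) (by simp)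
    (p := k + 1) (q := l) (n := m) (by omega) x.1 y.2.1
  have hB := coboundary_cupCochain (fun h w => vectorPairing V h w) (by simp) (by simp)
    (p := k) (q := l + 1) (n := m) (by omega) x.2.1 y.2.2.toCochain
  rw [← DForm.toCochain_d] at hB
  refine Prod.ext ?_ (Prod.ext ?_ ?_)
  · exact coboundary_cupCochain latticePairing
      (fun a a' b => Subtype.ext (by simp [latticePairing]))
      (fun a b b' => Subtype.ext (by simp [latticePairing])) (p := k + 1) (q := l + 1)
      (by omega) x.1 y.1
  · have hL : (DiffCochain.d (x.pairing hm y)).2.1 =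
        cupCochain (fun (c : Λ) (c' : dualLattice Λ) => vectorPairing V c c')
          (p := k + 1) (q := l + 1) (by omega) x.1 y.1 -
        (DForm.wedge (vectorPairing V) (p := k + 1) (q := l + 1) (by omega) x.2.2 y.2.2).toCochain -
        ((-1 : ℤ) ^ (k + 1) • coboundary (cupCochain (fun (c : Λ) h => vectorPairing V c h)
            (p := k + 1) (q := l) (n := m) (by omega) x.1 y.2.1) +
          coboundary (cupCochain (fun h w => vectorPairing V h w) (p := k) (q := l + 1) (n := m)
            (by omega) x.2.1 y.2.2.toCochain) +
          coboundary (cupWedgeHomotopy (vectorPairing V) (n := m) (by omega) x.2.2 y.2.2)) := by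
      rw [← coboundary_zsmul, ← coboundary_add, ← coboundary_add]
      rfl
    rw [hL, hA, hB, eq_sub_of_add_eq hD]
    funext s
    change _ = (((-1 : ℤ) ^ (k + 1 + 1) • _ + _ + _ : ℝ) +
      (-1 : ℤ) ^ (k + 1) • ((-1 : ℤ) ^ (k + 1) • _ + _ + _ : ℝ))
    simp only [d_apply, cupCochain, Pi.sub_apply, Pi.add_apply, Pi.smul_apply, map_sub,
      _root_.sub_apply, smul_add, smul_sub, smul_smul]
    -- What remains is bookkeeping of signs: `c₁ ∪ ω̃₂` occurs in both products and cancels, `ω̃₁ ∪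
    -- ω̃₂` comes from the homotopy formula on one side and from `dx` on the other.
    rcases Nat.even_or_odd k with h | h
    · simp only [pow_succ, h.neg_one_pow]
      simp only [mul_neg, mul_one, neg_smul, one_smul, neg_neg]
      abel
    · simp only [pow_succ, h.neg_one_pow]
      simp only [mul_neg, mul_one, neg_smul, one_smul, neg_neg]
      abel
  · exact DForm.d_wedge (vectorPairing V) (by omega) x.2.2 y.2.2

end DiffCochain

/-! ### The canonical twists and the morphism between them. -/

section Duality

variable {V : Type*} [NormedAddCommGroup V] [NormedSpace ℝ V]

namespace ClassifyingMaps

variable {Λ : Submodule ℤ V} {E B P X : Type*} [DiffeologicalSpace E]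
  [DiffeologicalSpace B] [DiffeologicalSpace P] [DiffeologicalSpace X] [AddAction (V ⧸ Λ) E]
  [AddAction (V ⧸ Λ) P] {U : ModelBundle Λ E B} {Q : TorusBundle Λ P X}

lemma d_object (F : ClassifyingMaps U Q) : F.object.d = 0 := by
  rw [object, DiffCochain.d_pullback, U.c_closed, DiffCochain.pullback_zero]

/-- The diagonal followed by the second projection is the identity, so this is `dα` pulled back
along the total classifying map; commutativity of the bundle square moves the pullback to the base.
-/
lemma d_diagonalTrivialisation (F : ClassifyingMaps U Q) :
    F.diagonalTrivialisation.d = F.object.pullback Q.proj Q.smooth_proj := by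
  rw [diagonalTrivialisation, DiffCochain.d_pullback, DiffCochain.d_pullback, U.d_α]
  exact DiffCochain.pullback_congr (f := U.bundle.proj ∘ F.total) (g := F.base ∘ Q.proj)
    (funext F.comm) (U.bundle.smooth_proj.comp F.smooth_total) (F.smooth_base.comp Q.smooth_proj) U.c

end ClassifyingMaps

namespace TDualityPair

variable [FiniteDimensional ℝ V] {Λ : Submodule ℤ V} {E B E' B' : Type*}
  [DiffeologicalSpace E] [DiffeologicalSpace B] [AddAction (V ⧸ Λ) E]
  [DiffeologicalSpace E'] [DiffeologicalSpace B'] [AddAction ((V →L[ℝ] ℝ) ⧸ dualLattice Λ) E']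
  {U : ModelBundle Λ E B} {U' : ModelBundle (dualLattice Λ) E' B'}
  {X P P' : Type*} [DiffeologicalSpace X] [DiffeologicalSpace P] [DiffeologicalSpace P']
  [AddAction (V ⧸ Λ) P] [AddAction ((V →L[ℝ] ℝ) ⧸ dualLattice Λ) P']

/-- Both terms have differential `π^*P · π^*P̂`, the second one because `π^*P̂` is closed and `dδ_P
= π^*P`. -/
lemma d_τ (D : TDualityPair U U' X P P') : D.τ.d = 0 := by
  rw [τ, map_sub, DiffCochain.d_pullback, D.d_σ, DiffCochain.d_pairing, DiffCochain.d_pullback,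
    ClassifyingMaps.d_object, DiffCochain.pullback_zero, DiffCochain.pairing_zero, smul_zero,
    add_zero, δ, ClassifyingMaps.d_diagonalTrivialisation, DiffCochain.pairing_pullback, sub_self]

lemma d_τ' (D : TDualityPair U U' X P P') : D.τ'.d = 0 := by
  rw [τ', map_sub, DiffCochain.d_pullback, D.d_σ, DiffCochain.d_pairing, DiffCochain.d_pullback,
    ClassifyingMaps.d_object, DiffCochain.pullback_zero, DiffCochain.zero_pairing, zero_add, δ',
    ClassifyingMaps.d_diagonalTrivialisation, DiffCochain.pairing_pullback]
  -- The closed factor on the left has even degree two, so the Leibniz sign is `+1`.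
  simp

/-- On the fibre product the two composites to `X` are equal. Hence the pullbacks of `σ` agree and
cancel, and `dδ_P`, `dδ̂` may be read as pullbacks through either factor. -/
lemma pullback_fst_τ (D : TDualityPair U U' X P P') :
    D.τ.pullback (FibreProduct.fst : D.Corr → P) FibreProduct.smooth_fst =
      D.τ'.pullback (FibreProduct.snd : D.Corr → P') FibreProduct.smooth_snd + D.δδ'.d := by
  have hproj : D.bundle.proj ∘ (FibreProduct.fst : D.Corr → P) =
      D.dualBundle.proj ∘ FibreProduct.snd := funext fun z => z.2
  have h1 : (D.δ.pullback (FibreProduct.fst : D.Corr → P) FibreProduct.smooth_fst).d =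
      (D.classifying.object.pullback D.dualBundle.proj D.dualBundle.smooth_proj).pullback
        FibreProduct.snd FibreProduct.smooth_snd := by
    rw [δ, DiffCochain.d_pullback, ClassifyingMaps.d_diagonalTrivialisation]
    exact DiffCochain.pullback_congr hproj (D.bundle.smooth_proj.comp FibreProduct.smooth_fst)
      (D.dualBundle.smooth_proj.comp FibreProduct.smooth_snd) D.classifying.object
  have h2 : (D.δ'.pullback (FibreProduct.snd : D.Corr → P') FibreProduct.smooth_snd).d =
      (D.dualClassifying.object.pullback D.bundle.proj D.bundle.smooth_proj).pullback
        FibreProduct.fst FibreProduct.smooth_fst := by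
    rw [δ', DiffCochain.d_pullback, ClassifyingMaps.d_diagonalTrivialisation]
    exact DiffCochain.pullback_congr hproj.symm (D.dualBundle.smooth_proj.comp FibreProduct.smooth_snd)
      (D.bundle.smooth_proj.comp FibreProduct.smooth_fst) D.dualClassifying.object
  have h3 : (D.σ.pullback D.bundle.proj D.bundle.smooth_proj).pullback
      (FibreProduct.fst : D.Corr → P) FibreProduct.smooth_fst =
      (D.σ.pullback D.dualBundle.proj D.dualBundle.smooth_proj).pullback
        FibreProduct.snd FibreProduct.smooth_snd :=
    DiffCochain.pullback_congr hproj (D.bundle.smooth_proj.comp FibreProduct.smooth_fst)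
      (D.dualBundle.smooth_proj.comp FibreProduct.smooth_snd) D.σ
  rw [τ, τ', δδ', DiffCochain.pullback_sub, DiffCochain.pullback_sub, DiffCochain.d_pairing, h1, h2,
    h3, DiffCochain.pairing_pullback, DiffCochain.pairing_pullback]
  -- The first factor `δ_P` has degree one, so the Leibniz sign is `-1`, as the difference of the
  -- twists requires.
  simp only [zero_add, pow_one, neg_smul, one_smul]
  abel

end TDualityPair

end Duality

end

theorem mainTheorem4 {V : Type*} [NormedAddCommGroup V] [NormedSpace ℝ V] [FiniteDimensional ℝ V]
    (Λ : Submodule ℤ V) [DiscreteTopology Λ] [IsZLattice ℝ Λ]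
    {E B E' B' : Type*}
    [DiffeologicalSpace E] [DiffeologicalSpace B] [AddAction (V ⧸ Λ) E]
    [DiffeologicalSpace E'] [DiffeologicalSpace B'] [AddAction ((V →L[ℝ] ℝ) ⧸ dualLattice Λ) E']
    (U : ModelBundle Λ E B) (U' : ModelBundle (dualLattice Λ) E' B')
    {n : ℕ} {X : Type*} [TopologicalSpace X] [ChartedSpace (EuclideanSpace ℝ (Fin n)) X]
    [IsManifold (𝓡 n) ∞ X] [DiffeologicalSpace X] [IsManifoldDiffeology (𝓡 n) X]
    {P P' : Type*} [DiffeologicalSpace P] [DiffeologicalSpace P']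
    [AddAction (V ⧸ Λ) P] [AddAction ((V →L[ℝ] ℝ) ⧸ dualLattice Λ) P']
    (D : TDualityPair U U' X P P') :
    D.τ.d = 0 ∧ D.τ'.d = 0 ∧
    ∃ (h : (D.τ.pullback (FibreProduct.fst : D.Corr → P) FibreProduct.smooth_fst).d = 0)
      (h' : (D.τ'.pullback (FibreProduct.snd : D.Corr → P') FibreProduct.smooth_snd).d = 0)
      (m : (⟨_, h⟩ : GeomGroupoid intLattice D.Corr 1) ⟶ ⟨_, h'⟩), m.cochain = D.δδ' := by
  refine ⟨D.d_τ, D.d_τ', ?_, ?_, ⟨D.δδ', D.pullback_fst_τ⟩, rfl⟩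
  · rw [DiffCochain.d_pullback, D.d_τ, DiffCochain.pullback_zero]
  · rw [DiffCochain.d_pullback, D.d_τ', DiffCochain.pullback_zero]
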